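/- For a probability measure $\mu$ on $\mathbb{R}$ let $G_\mu(z)=\int_{\mathbb{R}}\frac{d\mu(t)}{z-t}$ and $F_\mu(z)=1/G_\mu(z)$ ($F$-transform of $\mu$) for $z\in\mathbb{C}^+=\{\Im z>0\}$. The Voiculescu transform $\varphi_\mu(z)=F_\mu^{\langle -1\rangle}(z)-z$ is defined on truncated cones $\{\Im z>\beta,\ |\Re z|<\alpha\Im z\}$ ($\alpha>0$ arbitrary, $\beta>0$ large enough depending on $\mu$ and $\alpha$), where $F_\mu^{\langle -1\rangle}$ is the analytic right inverse of $F_\mu$ with values in $\mathbb{C}^+$ and $F_\mu^{\langle -1\rangle}(z)/z\to1$ as $z\to\infty$ in the cone. The free additive convolution $\mu\boxplus\nu$ of two probability measures is the unique probability measure $\rho$ such that for every $\alpha>0$ there is $\beta>0$ with $\varphi_\rho=\varphi_\mu+\varphi_\nu$ on $\{\Im z>\beta,\ |\Re z|<\alpha\Im z\}$. Theorem 1.3. Let $\mu_1,\mu_3$ be probability measures on $\mathbb{R}$ with finite second moment, and let $\sigma_1\ge 0$, where $\sigma_1^2$ is the variance of $\mu_1$. For $\Im z>2\sqrt2\,\sigma_1$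 put $T_z(w)=h_1(\tilde h_3(w)-z)+z$ with $h_1(w)=w-F_{\mu_1}(w)$ and $\tilde h_3(w)=F_{\mu_3}(w)+w$. Then for every $z$ with $\Im z>2\sqrt2\,\sigma_1$ and every $w$ with $\Im w>\tfrac34\Im z$ the iterates $T_z^{\circ n}(w)$ converge to a point $\omega_3(z)\in\mathbb{C}^+$ that does not depend on $w$, and: - the function $\tilde F_2(z)=F_{\mu_3}\big(\omega_3(z+2\sqrt2\,\sigma_1 i)\big)$ is analytic on $\mathbb{C}^+$; - there is a probability measure $\tilde\mu$ on $\mathbb{R}$ such that $\tilde F_2=F_{\tilde\mu}$ on $\mathbb{C}^+$, and $$\mu_1\boxplus\tilde\mu=\mu_3\boxplus\mathcal{C}_{2\sqrt2\,\sigma_1},$$ where $\mathcal{C}_\gamma$ is the centered Cauchy distribution with scale parameter $\gamma$, of density $\frac1\pi\frac{\gamma}{x^2+\gamma^2}$ if $\gamma>0$, and $\mathcal{C}_0=\delta_0$. -/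

import Mathlib

open MeasureTheory ProbabilityTheory Filter Topology
open scoped NNReal

namespace FreeDeconv

/-- The Cauchy transform `G_μ(z) = ∫ 1 / (z - t) dμ(t)` (used for `Im z > 0` only). -/
noncomputable def cauchyTransform (μ : Measure ℝ) (z : ℂ) : ℂ :=
  ∫ t : ℝ, 1 / (z - (t : ℂ)) ∂μ

/-- The `F`-transform (reciprocal Cauchy transform) `F_μ(z) = 1 / G_μ(z)`
(used for `Im z > 0` only). -/
noncomputable def fTransform (μ : Measure ℝ) (z : ℂ) : ℂ :=
  1 / cauchyTransform μ z

/-- The half-plane `{z : Im z > s}`; the open upper half-plane is `halfPlane 0`. -/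
def halfPlane (s : ℝ) : Set ℂ := {z | s < z.im}

/-- The truncated cone `{z : Im z > β, |Re z| < α Im z}`. -/
def truncCone (α β : ℝ) : Set ℂ := {z | β < z.im ∧ |z.re| < α * z.im}

/-- `φ` is the Voiculescu transform of `μ` on the truncated cone with parameters `α, β`: it is
`φ(z) = F_μ⁻¹(z) - z`, where `F_μ⁻¹` is the analytic right inverse of `F_μ` on the cone with values
in the upper half-plane and with `F_μ⁻¹(z) / z → 1` as `z → ∞` in the cone. Since `F_μ` is injective
on truncated cones that are far enough from the real axis, this branch is unique. -/
structure IsVoiculescuTransformOn (μ : Measure ℝ) (α β : ℝ) (φ : ℂ → ℂ) : Prop where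
  analytic : AnalyticOnNhd ℂ φ (truncCone α β)
  mem_upper : ∀ z ∈ truncCone α β, z + φ z ∈ halfPlane 0
  right_inv : ∀ z ∈ truncCone α β, fTransform μ (z + φ z) = z
  asymp : Tendsto (fun z => (z + φ z) / z)
    (Bornology.cobounded ℂ ⊓ 𝓟 (truncCone α β)) (𝓝 1)

/-- `ρ = μ ⊞ ν`, the free additive convolution of arbitrary probability measures on `ℝ`, as defined
by Bercovici and Voiculescu: `φ_ρ = φ_μ + φ_ν` on a truncated cone of every opening. The Voiculescu
transform determines the measure, so there is at most one such `ρ`. -/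
def IsFreeAddConv (μ ν ρ : Measure ℝ) : Prop :=
  IsProbabilityMeasure μ ∧ IsProbabilityMeasure ν ∧ IsProbabilityMeasure ρ ∧
    ∀ α : ℝ, 0 < α → ∃ β : ℝ, 0 < β ∧ ∃ φμ φν φρ : ℂ → ℂ,
      IsVoiculescuTransformOn μ α β φμ ∧ IsVoiculescuTransformOn ν α β φν ∧
      IsVoiculescuTransformOn ρ α β φρ ∧
      ∀ z ∈ truncCone α β, φρ z = φμ z + φν z

/-- `h_μ(w) = w - F_μ(w)`. -/
noncomputable def hTransform (μ : Measure ℝ) (w : ℂ) : ℂ := w - fTransform μ w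

/-- `h̃_μ(w) = F_μ(w) + w`. -/
noncomputable def hTilde (μ : Measure ℝ) (w : ℂ) : ℂ := fTransform μ w + w

/-- `T_z(w) = h_{μ₁}(h̃_{μ₃}(w) - z) + z`. -/
noncomputable def deconvMap (μ₁ μ₃ : Measure ℝ) (z w : ℂ) : ℂ :=
  hTransform μ₁ (hTilde μ₃ w - z) + z

/-- The subordination function `ω₃`: the limit of the iterates of `T_z`, here started at `z`
(for `Im z > 2√2 σ₁` the limit is the same for every starting point `w` with `Im w > 3 Im z / 4`,
see the first part of the theorem). -/
noncomputable def omega₃ (μ₁ μ₃ : Measure ℝ) (z : ℂ) : ℂ :=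
  limUnder atTop (fun n : ℕ => (deconvMap μ₁ μ₃ z)^[n] z)

end FreeDeconv

open FreeDeconv

/-!
The proof is complex analysis in half-planes, resting on one estimate. If `μ` has mean `m` and
variance `σ²`, the Cauchy–Schwarz inequality puts `h_μ(z)` in the closed disk with diameter from `m`
to `m - i σ² / Im z` (`im_mul_norm_hTransform_sub_sq_le`). With `y = Im z > 2√2 σ₁` this shows that
`T_z` maps the half-plane `Im w > 3y/4` into a strip `b < Im w ≤ y` with `b > 3y/4`. By the
Schwarz–Pick lemma (`schwarzPick_halfPlane`) such a map is a strict contraction for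
`‖u - v‖² / ((Im u - a) (Im v - a))`, `a = 3y/4`, so its iterates converge, locally uniformly in `z`,
to a fixed point `ω₃(z)` that is analytic in `z` and satisfies `‖ω₃(z) - z - m₁‖ ≤ 2σ₁² / y`.

Put `c = 2√2 σ₁`. If `c > 0`, then `z ↦ F_{μ₃}(ω₃(z + ic))` is at bounded distance from the
identity on the whole upper half-plane, with imaginary part at least `3c/4`. Functions of this kind
are `F`-transforms (`exists_fTransform_eq`): after a small vertical shift, Cauchy's theorem recovers
the reciprocal as the Cauchy transform of an explicit density, and the densities have a common
integrable bound, so Prokhorov's theorem provides a limit measure. If `c = 0`, the measure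
`μ₁` is a point mass and the measure sought is a translate of `μ₃`.

Both sides of the convolution identity are the classical convolution `ρ` of `μ₃` with the Cauchy
distribution, for which `F_ρ(z) = F_{μ₃}(z + ic)`. All `F`-transforms involved are at bounded
distance from the identity high up in the half-plane, so they have unique right inverses there
(`exists_rightInverse`), and the fixed point equation `F_{μ₁}(F_{μ₃}(ω) + ω - z) = F_{μ₃}(ω)` for
`ω = ω₃(z)` turns into the additivity of the Voiculescu transforms.
-/

namespace FreeDeconv

/-! ### Cauchy transforms and `F`-transforms on the upper half-plane -/

lemma isOpen_halfPlane (s : ℝ) : IsOpen (halfPlane s) :=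
  isOpen_lt continuous_const Complex.continuous_im

lemma sub_ofReal_ne_zero {z : ℂ} (hz : 0 < z.im) (t : ℝ) : z - (t : ℂ) ≠ 0 := by
  intro h
  have := congrArg Complex.im h
  simp at this
  exact hz.ne' this

lemma norm_one_div_sub_le {z : ℂ} (hz : 0 < z.im) (t : ℝ) : ‖1 / (z - (t : ℂ))‖ ≤ 1 / z.im := by
  rw [norm_div, norm_one]
  apply one_div_le_one_div_of_le hz
  simpa [abs_of_pos hz] using Complex.abs_im_le_norm (z - (t : ℂ))

lemma continuous_one_div_sub {z : ℂ} (hz : 0 < z.im) :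
    Continuous fun t : ℝ => 1 / (z - (t : ℂ)) :=
  continuous_const.div (by fun_prop) (sub_ofReal_ne_zero hz)

section

variable {μ : Measure ℝ} [IsProbabilityMeasure μ] {z : ℂ}

lemma integrable_one_div_sub (hz : 0 < z.im) : Integrable (fun t : ℝ => 1 / (z - (t : ℂ))) μ :=
  Integrable.of_bound (continuous_one_div_sub hz).aestronglyMeasurable (1 / z.im)
    (ae_of_all _ (norm_one_div_sub_le hz))

lemma integrable_norm_sq_one_div_sub (hz : 0 < z.im) :
    Integrable (fun t : ℝ => ‖1 / (z - (t : ℂ))‖ ^ 2) μ :=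
  Integrable.of_bound ((continuous_one_div_sub hz).norm.pow 2).aestronglyMeasurable
    ((1 / z.im) ^ 2) (ae_of_all _ fun t => by
      rw [Real.norm_of_nonneg (by positivity)]
      have := norm_one_div_sub_le hz t
      gcongr)

lemma im_one_div_sub (hz : 0 < z.im) (t : ℝ) :
    (1 / (z - (t : ℂ))).im = -z.im * ‖1 / (z - (t : ℂ))‖ ^ 2 := by
  have h := sub_ofReal_ne_zero hz t
  rw [norm_div, norm_one, div_pow, one_pow, one_div, Complex.inv_im, ← Complex.normSq_eq_norm_sq]
  simp [div_eq_mul_inv]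

lemma im_cauchyTransform (hz : 0 < z.im) :
    (cauchyTransform μ z).im = -z.im * ∫ t : ℝ, ‖1 / (z - (t : ℂ))‖ ^ 2 ∂μ := by
  rw [← integral_const_mul]
  simp_rw [← im_one_div_sub hz]
  exact (integral_im (integrable_one_div_sub hz)).symm

lemma im_cauchyTransform_neg (hz : 0 < z.im) : (cauchyTransform μ z).im < 0 := by
  rw [im_cauchyTransform hz, neg_mul, neg_lt_zero]
  apply mul_pos hz
  rw [integral_pos_iff_support_of_nonneg (fun t => by positivity)
    (integrable_norm_sq_one_div_sub hz)]
  have : Function.support (fun t : ℝ => ‖1 / (z - (t : ℂ))‖ ^ 2) = Set.univ := by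
    ext t
    simpa using sub_ofReal_ne_zero hz t
  rw [this]
  simp

lemma cauchyTransform_ne_zero (hz : 0 < z.im) : cauchyTransform μ z ≠ 0 := by
  intro h
  have := im_cauchyTransform_neg (μ := μ) hz
  simp [h] at this

/-- The variance identity `∫ |g - G|² = ∫ |g|² - |G|²` for `g(t) = 1 / (z - t)`, `G = ∫ g`. -/
lemma integral_norm_sq_sub_cauchyTransform (hz : 0 < z.im) :
    ∫ t : ℝ, ‖1 / (z - (t : ℂ)) - cauchyTransform μ z‖ ^ 2 ∂μ =
      (∫ t : ℝ, ‖1 / (z - (t : ℂ))‖ ^ 2 ∂μ) - ‖cauchyTransform μ z‖ ^ 2 := by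
  set G := cauchyTransform μ z with hG
  have hi := integrable_one_div_sub (μ := μ) hz
  have key : ∀ t : ℝ, ‖1 / (z - (t : ℂ)) - G‖ ^ 2 =
      ‖1 / (z - (t : ℂ))‖ ^ 2 + ‖G‖ ^ 2 - 2 * (1 / (z - (t : ℂ)) * (starRingEnd ℂ) G).re := by
    intro t
    rw [← Complex.normSq_eq_norm_sq, ← Complex.normSq_eq_norm_sq, ← Complex.normSq_eq_norm_sq,
      Complex.normSq_sub]
  simp_rw [key]
  have hre : Integrable (fun t : ℝ => (1 / (z - (t : ℂ)) * (starRingEnd ℂ) G).re) μ :=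
    (hi.mul_const _).re
  have h2 : ∫ t : ℝ, (1 / (z - (t : ℂ)) * (starRingEnd ℂ) G).re ∂μ = ‖G‖ ^ 2 := by
    have h3 : ∫ t : ℝ, (1 / (z - (t : ℂ)) * (starRingEnd ℂ) G).re ∂μ =
        (∫ t : ℝ, (1 / (z - (t : ℂ)) * (starRingEnd ℂ) G) ∂μ).re :=
      integral_re (hi.mul_const _)
    rw [h3, integral_mul_const]
    change (G * (starRingEnd ℂ) G).re = _
    rw [Complex.mul_conj, Complex.ofReal_re, Complex.normSq_eq_norm_sq]
  have hadd : Integrable (fun t : ℝ => ‖1 / (z - (t : ℂ))‖ ^ 2 + ‖G‖ ^ 2) μ :=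
    (integrable_norm_sq_one_div_sub hz).add (integrable_const _)
  rw [integral_sub hadd (hre.const_mul 2),
    integral_add (integrable_norm_sq_one_div_sub hz) (integrable_const _),
    integral_const_mul, h2]
  simp
  ring

lemma im_fTransform (hz : 0 < z.im) :
    (fTransform μ z).im * ‖cauchyTransform μ z‖ ^ 2 =
      z.im * ∫ t : ℝ, ‖1 / (z - (t : ℂ))‖ ^ 2 ∂μ := by
  have h0 : ‖cauchyTransform μ z‖ ^ 2 ≠ 0 := by
    simpa using cauchyTransform_ne_zero (μ := μ) hz
  rw [fTransform, one_div, Complex.inv_im, Complex.normSq_eq_norm_sq, im_cauchyTransform hz,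
    div_mul_cancel₀ _ h0, neg_mul, neg_neg]

lemma im_le_im_fTransform (hz : 0 < z.im) : z.im ≤ (fTransform μ z).im := by
  have h0 : 0 < ‖cauchyTransform μ z‖ ^ 2 := by
    have := norm_pos_iff.2 (cauchyTransform_ne_zero (μ := μ) hz)
    positivity
  have h1 : 0 ≤ ∫ t : ℝ, ‖1 / (z - (t : ℂ)) - cauchyTransform μ z‖ ^ 2 ∂μ :=
    integral_nonneg fun t => by positivity
  rw [integral_norm_sq_sub_cauchyTransform hz] at h1
  have h2 := im_fTransform (μ := μ) hz
  refine le_of_mul_le_mul_right ?_ h0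
  rw [h2]
  gcongr
  linarith

lemma differentiableOn_cauchyTransform :
    DifferentiableOn ℂ (cauchyTransform μ) (halfPlane 0) := by
  intro z hz
  have h := hasDerivAt_resolventTransform (𝕜 := ℝ) (μ := μ) z (by
    rintro ⟨t, -, ht⟩
    have := congrArg Complex.im ht
    simp at this
    exact (show (0 : ℝ) < z.im from hz).ne this)
  have h2 : cauchyTransform μ = fun z => - resolventTransform μ z := by
    ext z
    rw [cauchyTransform, resolventTransform_apply, ← integral_neg]
    congr 1
    ext t
    rw [resolvent, Ring.inverse_eq_inv', one_div, ← inv_neg]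
    simp
  rw [h2]
  exact h.neg.differentiableAt.differentiableWithinAt

lemma differentiableOn_fTransform : DifferentiableOn ℂ (fTransform μ) (halfPlane 0) := by
  have : fTransform μ = fun z => 1 / cauchyTransform μ z := rfl
  rw [this]
  exact (differentiableOn_const 1).div differentiableOn_cauchyTransform
    fun z hz => cauchyTransform_ne_zero hz

/-- The sharp estimate on `h_μ(z) = z - F_μ(z)` for a measure of finite variance: `h_μ(z)` lies in
the closed disk with diameter from the mean `m` to `m - i σ² / Im z`. It follows from the
Cauchy–Schwarz inequality applied to `h_μ(z) - m = G_μ(z)⁻¹ ∫ (t - m) (1 / (z - t) - G_μ(z)) dμ(t)`,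
and replaces the Nevanlinna representation of `F_μ`. -/
lemma im_mul_norm_hTransform_sub_sq_le (h : MemLp id 2 μ) (hz : 0 < z.im) :
    z.im * ‖hTransform μ z - ((∫ t, t ∂μ : ℝ) : ℂ)‖ ^ 2 ≤
      variance id μ * -(hTransform μ z).im := by
  set m : ℝ := ∫ t, t ∂μ with hm
  set G := cauchyTransform μ z with hG
  have hG0 : G ≠ 0 := cauchyTransform_ne_zero hz
  have hi := integrable_one_div_sub (μ := μ) hz
  have hid : Integrable (fun t : ℝ => t) μ := h.integrable (by norm_num)
  have hidc : Integrable (fun t : ℝ => ((t : ℝ) : ℂ) - m) μ :=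
    hid.ofReal.sub (integrable_const _)
  have hcent : ∫ t : ℝ, ((t : ℂ) - m) ∂μ = 0 := by
    rw [integral_sub hid.ofReal (integrable_const _), integral_complex_ofReal]
    simp [hm]
  have hprod : ∀ t : ℝ, ((t : ℂ) - m) * (1 / (z - t)) = (z - m) * (1 / (z - t)) - 1 := by
    intro t
    have := sub_ofReal_ne_zero hz t
    field_simp
    ring
  have hH : ∫ t : ℝ, ((t : ℂ) - m) * (1 / (z - t) - G) ∂μ = (z - m) * G - 1 := by
    have h1 : ∀ t : ℝ, ((t : ℂ) - m) * (1 / (z - t) - G) =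
        ((z - m) * (1 / (z - t)) - 1) - ((t : ℂ) - m) * G := by
      intro t
      rw [mul_sub, hprod]
    simp_rw [h1]
    have hsub : Integrable (fun t : ℝ => (z - m) * (1 / (z - (t : ℂ))) - 1) μ :=
      (hi.const_mul _).sub (integrable_const _)
    rw [integral_sub hsub (hidc.mul_const _),
      integral_sub (hi.const_mul _) (integrable_const _), integral_mul_const, hcent,
      integral_const_mul]
    simp [hG, cauchyTransform]
  have hh : (hTransform μ z - m) * G = (z - m) * G - 1 := by
    rw [hTransform, fTransform, ← hG]
    field_simp
    ring
  have hvar : variance id μ = ∫ t : ℝ, ‖(t : ℂ) - m‖ ^ 2 ∂μ := by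
    rw [variance_eq_integral aemeasurable_id]
    congr 1
    ext t
    rw [← Complex.ofReal_sub, Complex.norm_real, Real.norm_eq_abs, sq_abs]
    simp [hm]
  have hCS : ‖(z - m) * G - 1‖ ^ 2 ≤
      variance id μ * ((∫ t : ℝ, ‖1 / (z - (t : ℂ))‖ ^ 2 ∂μ) - ‖G‖ ^ 2) := by
    rw [← hH, hvar, ← integral_norm_sq_sub_cauchyTransform hz]
    have hf : MemLp (fun t : ℝ => (t : ℂ) - m) (ENNReal.ofReal 2) μ := by
      have : MemLp (fun t : ℝ => ((id t : ℝ) : ℂ)) 2 μ := h.ofReal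
      rw [ENNReal.ofReal_ofNat]
      exact this.sub (memLp_const (m : ℂ))
    have hg : MemLp (fun t : ℝ => 1 / (z - (t : ℂ)) - G) (ENNReal.ofReal 2) μ := by
      have : MemLp (fun t : ℝ => 1 / (z - (t : ℂ))) 2 μ :=
        MemLp.of_bound (continuous_one_div_sub hz).aestronglyMeasurable (1 / z.im)
          (ae_of_all _ (norm_one_div_sub_le hz))
      rw [ENNReal.ofReal_ofNat]
      exact this.sub (memLp_const G)
    have hle := integral_mul_norm_le_Lp_mul_Lq (Real.HolderConjugate.two_two) hf hg
    simp only [Real.rpow_two, ← Real.sqrt_eq_rpow] at hle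
    have h3 := (norm_integral_le_integral_norm (μ := μ)
      fun t : ℝ => ((t : ℂ) - m) * (1 / (z - t) - G))
    simp_rw [norm_mul] at h3
    refine (pow_le_pow_left₀ (norm_nonneg _) (h3.trans hle) 2).trans ?_
    rw [mul_pow, Real.sq_sqrt (integral_nonneg fun t => by positivity),
      Real.sq_sqrt (integral_nonneg fun t => by positivity)]
  have hF := im_fTransform (μ := μ) hz
  have hn : 0 < ‖G‖ ^ 2 := by positivity
  refine le_of_mul_le_mul_right ?_ hn
  have e1 : (hTransform μ z).im = z.im - (fTransform μ z).im := by simp [hTransform]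
  have e2 : ‖(z - m) * G - 1‖ ^ 2 = ‖hTransform μ z - m‖ ^ 2 * ‖G‖ ^ 2 := by
    rw [← hh, norm_mul, mul_pow]
  calc z.im * ‖hTransform μ z - m‖ ^ 2 * ‖G‖ ^ 2
      = z.im * ‖(z - m) * G - 1‖ ^ 2 := by rw [e2]; ring
    _ ≤ z.im * (variance id μ * ((∫ t : ℝ, ‖1 / (z - (t : ℂ))‖ ^ 2 ∂μ) - ‖G‖ ^ 2)) := by gcongr
    _ = variance id μ * -(hTransform μ z).im * ‖G‖ ^ 2 := by
      rw [e1]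
      linear_combination variance id μ * (-hF)

lemma im_hTransform_nonpos (hz : 0 < z.im) : (hTransform μ z).im ≤ 0 := by
  have := im_le_im_fTransform (μ := μ) hz
  simp [hTransform]
  exact this

lemma norm_hTransform_sub_mean_le (h : MemLp id 2 μ) (hz : 0 < z.im) :
    ‖hTransform μ z - ((∫ t, t ∂μ : ℝ) : ℂ)‖ ≤ variance id μ / z.im := by
  set m : ℝ := ∫ t, t ∂μ with hm
  have h1 := im_mul_norm_hTransform_sub_sq_le h hz
  have h2 : -(hTransform μ z).im ≤ ‖hTransform μ z - m‖ := by
    have := Complex.abs_im_le_norm (hTransform μ z - m)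
    simp at this
    exact (neg_le_abs _).trans this
  have h3 := variance_nonneg (id : ℝ → ℝ) μ
  rw [le_div_iff₀ hz]
  rcases (norm_nonneg (hTransform μ z - m)).eq_or_lt with h0 | h0
  · rw [← h0, zero_mul]
    exact h3
  · refine le_of_mul_le_mul_right ?_ h0
    calc ‖hTransform μ z - m‖ * z.im * ‖hTransform μ z - m‖
        = z.im * ‖hTransform μ z - m‖ ^ 2 := by ring
      _ ≤ variance id μ * -(hTransform μ z).im := h1
      _ ≤ _ := by gcongr

lemma norm_fTransform_sub_le (h : MemLp id 2 μ) {s : ℝ} (hs : 0 < s) (hz : s < z.im) :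
    ‖fTransform μ z - z‖ ≤ |∫ t, t ∂μ| + variance id μ / s := by
  have h1 := norm_hTransform_sub_mean_le h (hs.trans hz)
  have h3 := variance_nonneg (id : ℝ → ℝ) μ
  calc ‖fTransform μ z - z‖
      = ‖((∫ t, t ∂μ : ℝ) : ℂ) + (hTransform μ z - ((∫ t, t ∂μ : ℝ) : ℂ))‖ := by
        rw [add_sub_cancel, hTransform, norm_sub_rev]
    _ ≤ ‖((∫ t, t ∂μ : ℝ) : ℂ)‖ + ‖hTransform μ z - ((∫ t, t ∂μ : ℝ) : ℂ)‖ := norm_add_le _ _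
    _ ≤ |∫ t, t ∂μ| + variance id μ / s := by
      rw [Complex.norm_real, Real.norm_eq_abs]
      gcongr
      exact h1.trans (by gcongr)

end

/-! ### The Schwarz–Pick lemma and iteration in half-planes -/

lemma norm_sub_conj_sq (p q : ℂ) :
    ‖p - (starRingEnd ℂ) q‖ ^ 2 = ‖p - q‖ ^ 2 + 4 * p.im * q.im := by
  rw [← Complex.normSq_eq_norm_sq, ← Complex.normSq_eq_norm_sq, Complex.normSq_apply,
    Complex.normSq_apply]
  simp
  ring

lemma norm_sub_le_norm_sub_conj {p q : ℂ} (hp : 0 < p.im) (hq : 0 < q.im) :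
    ‖p - q‖ ≤ ‖p - (starRingEnd ℂ) q‖ := by
  refine le_of_sq_le_sq ?_ (norm_nonneg _)
  rw [norm_sub_conj_sq]
  nlinarith [mul_pos hp hq]

lemma sub_conj_ne_zero {p q : ℂ} (hp : 0 < p.im) (hq : 0 < q.im) :
    p - (starRingEnd ℂ) q ≠ 0 := by
  intro h
  have := congrArg Complex.im h
  simp at this
  linarith

lemma schwarzPick_upperHalfPlane {f : ℂ → ℂ} (hd : DifferentiableOn ℂ f (halfPlane 0))
    (hm : Set.MapsTo f (halfPlane 0) (halfPlane 0)) {z w : ℂ} (hz : 0 < z.im) (hw : 0 < w.im) :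
    ‖f z - f w‖ ^ 2 * (z.im * w.im) ≤ ‖z - w‖ ^ 2 * ((f z).im * (f w).im) := by
  -- the inverse of the Cayley transform sending `w` to `0`
  set κ : ℂ → ℂ := fun u => (w - (starRingEnd ℂ) w * u) / (1 - u) with hκ
  have h1u : ∀ u ∈ Metric.ball (0 : ℂ) 1, 1 - u ≠ 0 := by
    intro u hu h
    rw [sub_eq_zero] at h
    simp [← h] at hu
  have hκim : ∀ u ∈ Metric.ball (0 : ℂ) 1, κ u ∈ halfPlane 0 := by
    intro u hu
    have hn : 0 < Complex.normSq (1 - u) := Complex.normSq_pos.2 (h1u u hu)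
    have hu1 : Complex.normSq u < 1 := by
      rw [Complex.normSq_eq_norm_sq]
      have : ‖u‖ < 1 := by simpa using hu
      nlinarith [norm_nonneg u]
    have : (κ u).im = w.im * (1 - Complex.normSq u) / Complex.normSq (1 - u) := by
      rw [hκ]
      simp only [Complex.div_im]
      rw [← sub_div]
      congr 1
      simp [Complex.normSq_apply]
      ring
    change 0 < (κ u).im
    rw [this]
    exact div_pos (mul_pos hw (by linarith)) hn
  have hκd : DifferentiableOn ℂ κ (Metric.ball 0 1) :=
    DifferentiableOn.div (by fun_prop) (by fun_prop) h1u
  have hfw : 0 < (f w).im := hm hw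
  have hfz : 0 < (f z).im := hm hz
  set g : ℂ → ℂ := fun u => (f (κ u) - f w) / (f (κ u) - (starRingEnd ℂ) (f w)) with hg
  have hgd : DifferentiableOn ℂ g (Metric.ball 0 1) := by
    have : DifferentiableOn ℂ (fun u => f (κ u)) (Metric.ball 0 1) := hd.comp hκd hκim
    exact (this.sub_const _).div (this.sub_const _)
      fun u hu => sub_conj_ne_zero (hm (hκim u hu)) hfw
  have hgm : Set.MapsTo g (Metric.ball 0 1) (Metric.closedBall 0 1) := by
    intro u hu
    rw [mem_closedBall_zero_iff, hg]
    simp only [norm_div]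
    exact div_le_one_of_le₀ (norm_sub_le_norm_sub_conj (hm (hκim u hu)) hfw) (norm_nonneg _)
  have hg0 : g 0 = 0 := by simp [hg, hκ]
  have hzw := sub_conj_ne_zero hz hw
  set u : ℂ := (z - w) / (z - (starRingEnd ℂ) w) with hu
  have hpos : 0 < ‖z - (starRingEnd ℂ) w‖ := norm_pos_iff.2 hzw
  have hu1 : ‖u‖ < 1 := by
    rw [hu, norm_div, div_lt_one hpos]
    refine lt_of_pow_lt_pow_left₀ 2 hpos.le ?_
    rw [norm_sub_conj_sq]
    nlinarith [mul_pos hz hw]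
  have hκu : κ u = z := by
    have h2 : 1 - u ≠ 0 := h1u u (by simpa using hu1)
    rw [hκ]
    simp only
    rw [div_eq_iff h2, hu]
    field_simp
    ring
  have hS := Complex.norm_le_norm_of_mapsTo_ball hgd hgm hg0 hu1
  have hpos' : 0 < ‖f z - (starRingEnd ℂ) (f w)‖ := norm_pos_iff.2 (sub_conj_ne_zero hfz hfw)
  rw [hg] at hS
  simp only [hκu] at hS
  rw [hu, norm_div, norm_div, div_le_div_iff₀ hpos' hpos] at hS
  have hS2 := pow_le_pow_left₀ (by positivity) hS 2
  rw [mul_pow, mul_pow, norm_sub_conj_sq, norm_sub_conj_sq] at hS2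
  linarith

/-- The **Schwarz–Pick lemma** for holomorphic maps between half-planes, in the form that
`‖z - w‖ ^ 2 / ((Im z - a) (Im w - a))`, a function of the hyperbolic distance, does not
increase. -/
theorem schwarzPick_halfPlane {f : ℂ → ℂ} {a b : ℝ} (hd : DifferentiableOn ℂ f (halfPlane a))
    (hm : Set.MapsTo f (halfPlane a) (halfPlane b)) {z w : ℂ} (hz : z ∈ halfPlane a)
    (hw : w ∈ halfPlane a) :
    ‖f z - f w‖ ^ 2 * ((z.im - a) * (w.im - a)) ≤
      ‖z - w‖ ^ 2 * (((f z).im - b) * ((f w).im - b)) := by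
  have hshift : Set.MapsTo (fun ζ : ℂ => ζ + a * Complex.I) (halfPlane 0) (halfPlane a) := by
    intro ζ hζ
    simp only [halfPlane, Set.mem_ofPred_eq] at hζ ⊢
    simp
    exact hζ
  have h := schwarzPick_upperHalfPlane (f := fun ζ => f (ζ + a * Complex.I) - b * Complex.I)
    (z := z - a * Complex.I) (w := w - a * Complex.I)
    ((hd.comp (by fun_prop) hshift).sub_const _)
    (fun ζ hζ => by
      have : b < (f (ζ + a * Complex.I)).im := hm (hshift hζ)
      simpa [halfPlane] using this)
    (by simpa [halfPlane] using hz) (by simpa [halfPlane] using hw)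
  simpa using h

section Iteration

variable {T : ℂ → ℂ} {a b M : ℝ}

lemma norm_sub_sq_le_of_mapsTo_strip (hd : DifferentiableOn ℂ T (halfPlane a)) (hab : a < b)
    (hT : ∀ w ∈ halfPlane a, b < (T w).im ∧ (T w).im ≤ M) {u v : ℂ} (hu : u ∈ halfPlane a)
    (hv : v ∈ halfPlane a) :
    ‖T u - T v‖ ^ 2 * ((u.im - a) * (v.im - a)) ≤
      ((M - b) / (M - a)) ^ 2 * ‖u - v‖ ^ 2 * (((T u).im - a) * ((T v).im - a)) := by
  have h := schwarzPick_halfPlane hd (fun w hw => (hT w hw).1) hu hv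
  have hk : ∀ w ∈ halfPlane a, (T w).im - b ≤ (M - b) / (M - a) * ((T w).im - a) := by
    intro w hw
    obtain ⟨h1, h2⟩ := hT w hw
    rw [div_mul_eq_mul_div, le_div_iff₀ (by linarith)]
    nlinarith
  refine h.trans ?_
  obtain ⟨h1, h2⟩ := hT u hu
  obtain ⟨h3, h4⟩ := hT v hv
  have h5 : ((T u).im - b) * ((T v).im - b) ≤
      ((M - b) / (M - a) * ((T u).im - a)) * ((M - b) / (M - a) * ((T v).im - a)) :=
    mul_le_mul (hk u hu) (hk v hv) (by linarith) (by
      have := hk u hu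
      linarith)
  calc _ ≤ ‖u - v‖ ^ 2 * (((M - b) / (M - a) * ((T u).im - a)) *
        ((M - b) / (M - a) * ((T v).im - a))) := by gcongr
    _ = _ := by ring

lemma iterate_mem_halfPlane (hab : a < b)
    (hT : ∀ w ∈ halfPlane a, b < (T w).im ∧ (T w).im ≤ M) {u : ℂ} (hu : u ∈ halfPlane a)
    (n : ℕ) : T^[n] u ∈ halfPlane a := by
  induction n with
  | zero => exact hu
  | succ n ih =>
    rw [Function.iterate_succ_apply']
    exact hab.trans (hT _ ih).1

lemma norm_iterate_sub_sq_le (hd : DifferentiableOn ℂ T (halfPlane a)) (hab : a < b)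
    (hT : ∀ w ∈ halfPlane a, b < (T w).im ∧ (T w).im ≤ M) {u v : ℂ} (hu : u ∈ halfPlane a)
    (hv : v ∈ halfPlane a) (n : ℕ) :
    ‖T^[n] u - T^[n] v‖ ^ 2 * ((u.im - a) * (v.im - a)) ≤
      (((M - b) / (M - a)) ^ n) ^ 2 * ‖u - v‖ ^ 2 *
        (((T^[n] u).im - a) * ((T^[n] v).im - a)) := by
  induction n with
  | zero => simp
  | succ n ih =>
    have hp := iterate_mem_halfPlane hab hT hu n
    have hq := iterate_mem_halfPlane hab hT hv n
    rw [Function.iterate_succ_apply', Function.iterate_succ_apply']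
    set p := T^[n] u
    set q := T^[n] v
    have h := norm_sub_sq_le_of_mapsTo_strip hd hab hT hp hq
    have hP : 0 < (p.im - a) * (q.im - a) := mul_pos (sub_pos.2 hp) (sub_pos.2 hq)
    have hP' : 0 < ((T p).im - a) * ((T q).im - a) :=
      mul_pos (sub_pos.2 (hab.trans (hT p hp).1)) (sub_pos.2 (hab.trans (hT q hq).1))
    have hD : 0 < (u.im - a) * (v.im - a) := mul_pos (sub_pos.2 hu) (sub_pos.2 hv)
    set k := (M - b) / (M - a)
    refine le_of_mul_le_mul_right ?_ hP
    calc ‖T p - T q‖ ^ 2 * ((u.im - a) * (v.im - a)) * ((p.im - a) * (q.im - a))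
        = ‖T p - T q‖ ^ 2 * ((p.im - a) * (q.im - a)) * ((u.im - a) * (v.im - a)) := by ring
      _ ≤ k ^ 2 * ‖p - q‖ ^ 2 * (((T p).im - a) * ((T q).im - a)) *
          ((u.im - a) * (v.im - a)) := by gcongr
      _ = k ^ 2 * (((T p).im - a) * ((T q).im - a)) *
          (‖p - q‖ ^ 2 * ((u.im - a) * (v.im - a))) := by ring
      _ ≤ k ^ 2 * (((T p).im - a) * ((T q).im - a)) *
          ((k ^ n) ^ 2 * ‖u - v‖ ^ 2 * ((p.im - a) * (q.im - a))) := by gcongr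
      _ = _ := by ring

/-- Started on the upper edge of the strip, the iterates have geometrically decaying increments. -/
lemma dist_iterate_succ_le (hd : DifferentiableOn ℂ T (halfPlane a)) (hab : a < b)
    (hT : ∀ w ∈ halfPlane a, b < (T w).im ∧ (T w).im ≤ M) {u : ℂ} (hu : u ∈ halfPlane a)
    (huM : u.im = M) (n : ℕ) :
    dist (T^[n] u) (T^[n + 1] u) ≤
      ‖u - T u‖ / (1 - (M - b) / (M - a)) * ((M - b) / (M - a)) ^ n := by
  have hTu := hT u hu
  have hv : T u ∈ halfPlane a := hab.trans hTu.1
  have hle : ∀ m, (T^[m] u).im ≤ M := by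
    intro m
    cases m with
    | zero => exact huM.le
    | succ m =>
      rw [Function.iterate_succ_apply']
      exact (hT _ (iterate_mem_halfPlane hab hT hu m)).2
  have h := norm_iterate_sub_sq_le hd hab hT hu hv n
  rw [← Function.iterate_succ_apply] at h
  rw [dist_eq_norm]
  have hMa : 0 < M - a := by linarith
  have hMb : 0 < M - b := by linarith
  set k := (M - b) / (M - a) with hk
  have hk0 : 0 ≤ k := by positivity
  have h1k : 1 - k = (b - a) / (M - a) := by
    rw [hk]
    field_simp
    ring
  have hk1 : 0 < 1 - k := by
    rw [h1k]
    exact div_pos (by linarith) hMa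
  rw [div_mul_eq_mul_div, le_div_iff₀ hk1]
  refine le_of_sq_le_sq ?_ (by positivity)
  set N := ‖T^[n] u - T^[n + 1] u‖
  have hp := iterate_mem_halfPlane hab hT hu n
  have hq := iterate_mem_halfPlane hab hT hu (n + 1)
  simp only [halfPlane, Set.mem_ofPred_eq] at hp hq
  have hb : (1 - k) * (M - a) = b - a := by
    rw [h1k]
    field_simp
  have hmain : N ^ 2 * (1 - k) * (M - a) ^ 2 ≤ (k ^ n) ^ 2 * ‖u - T u‖ ^ 2 * (M - a) ^ 2 := by
    calc N ^ 2 * (1 - k) * (M - a) ^ 2 = N ^ 2 * ((M - a) * (b - a)) := by rw [← hb]; ring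
      _ ≤ N ^ 2 * ((u.im - a) * ((T u).im - a)) := by
        rw [huM]
        have := hTu.1
        gcongr
      _ ≤ _ := h
      _ ≤ (k ^ n) ^ 2 * ‖u - T u‖ ^ 2 * ((M - a) * (M - a)) := by
        have h1 := hle n
        have h2 := hle (n + 1)
        have : ((T^[n] u).im - a) * ((T^[n + 1] u).im - a) ≤ (M - a) * (M - a) :=
          mul_le_mul (by linarith) (by linarith) (by linarith) (by linarith)
        gcongr
      _ = _ := by ring
  have hmain' := le_of_mul_le_mul_right hmain (by positivity)
  calc (N * (1 - k)) ^ 2 = N ^ 2 * (1 - k) * (1 - k) := by ring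
    _ ≤ N ^ 2 * (1 - k) * 1 := by
      gcongr
      linarith
    _ ≤ _ := by linarith [hmain', mul_pow ‖u - T u‖ (k ^ n) 2]

lemma tendsto_iterate_sub_iterate (hd : DifferentiableOn ℂ T (halfPlane a)) (hab : a < b)
    (hT : ∀ w ∈ halfPlane a, b < (T w).im ∧ (T w).im ≤ M) {u v : ℂ} (hu : u ∈ halfPlane a)
    (hv : v ∈ halfPlane a) :
    Tendsto (fun n => T^[n] u - T^[n] v) atTop (𝓝 0) := by
  rw [← tendsto_add_atTop_iff_nat 1]
  have hTu := hT u hu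
  have hMa : 0 < M - a := by linarith
  have hMb : 0 < M - b := by linarith
  set k := (M - b) / (M - a) with hk
  have hk0 : 0 ≤ k := by positivity
  have hk1 : k < 1 := by
    rw [hk, div_lt_one hMa]
    linarith
  have hD : 0 < (u.im - a) * (v.im - a) := mul_pos (sub_pos.2 hu) (sub_pos.2 hv)
  have hbound : ∀ n, ‖T^[n + 1] u - T^[n + 1] v‖ ^ 2 ≤
      (k ^ (n + 1)) ^ 2 * (‖u - v‖ ^ 2 * (M - a) ^ 2 / ((u.im - a) * (v.im - a))) := by
    intro n
    have h := norm_iterate_sub_sq_le hd hab hT hu hv (n + 1)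
    rw [← mul_div_assoc, le_div_iff₀ hD]
    refine h.trans ?_
    have e : ∀ w ∈ halfPlane a, (T^[n + 1] w).im ≤ M ∧ a < (T^[n + 1] w).im := by
      intro w hw
      refine ⟨?_, iterate_mem_halfPlane hab hT hw (n + 1)⟩
      rw [Function.iterate_succ_apply']
      exact (hT _ (iterate_mem_halfPlane hab hT hw n)).2
    obtain ⟨h1, h2⟩ := e u hu
    obtain ⟨h3, h4⟩ := e v hv
    have : ((T^[n + 1] u).im - a) * ((T^[n + 1] v).im - a) ≤ (M - a) * (M - a) :=
      mul_le_mul (by linarith) (by linarith) (by linarith) (by linarith)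
    calc _ ≤ (k ^ (n + 1)) ^ 2 * ‖u - v‖ ^ 2 * ((M - a) * (M - a)) := by gcongr
      _ = _ := by ring
  have hlim : Tendsto (fun n : ℕ =>
      (k ^ (n + 1)) ^ 2 * (‖u - v‖ ^ 2 * (M - a) ^ 2 / ((u.im - a) * (v.im - a))))
      atTop (𝓝 0) := by
    have := ((tendsto_add_atTop_iff_nat 1).2 (tendsto_pow_atTop_nhds_zero_of_lt_one hk0 hk1)).pow 2
    simpa using this.mul_const (‖u - v‖ ^ 2 * (M - a) ^ 2 / ((u.im - a) * (v.im - a)))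
  have h2 := squeeze_zero (fun n => by positivity) hbound hlim
  have h3 := (Real.continuous_sqrt.tendsto 0).comp h2
  rw [tendsto_zero_iff_norm_tendsto_zero]
  simpa [Function.comp_def, Real.sqrt_sq (norm_nonneg _)] using h3

end Iteration

/-! ### The subordination function -/

section Subordination

variable {μ₁ μ₃ : Measure ℝ} [IsProbabilityMeasure μ₁] [IsProbabilityMeasure μ₃] {z w : ℂ}

lemma pos_of_mem_halfPlane {s : ℝ} (hs : 0 ≤ s) (hz : z ∈ halfPlane s) : 0 < z.im :=
  hs.trans_lt hz

lemma half_lt_im_hTilde_sub (hz : 0 < z.im) (hw : w ∈ halfPlane (3 * z.im / 4)) :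
    z.im / 2 < (hTilde μ₃ w - z).im := by
  have hw' : 3 * z.im / 4 < w.im := hw
  have := im_le_im_fTransform (μ := μ₃) (show 0 < w.im by linarith)
  simp [hTilde]
  linarith

lemma differentiableOn_hTransform {μ : Measure ℝ} [IsProbabilityMeasure μ] :
    DifferentiableOn ℂ (hTransform μ) (halfPlane 0) :=
  differentiableOn_id.sub differentiableOn_fTransform

lemma differentiableOn_deconvMap (hz : 0 < z.im) :
    DifferentiableOn ℂ (deconvMap μ₁ μ₃ z) (halfPlane (3 * z.im / 4)) := by
  have h1 : DifferentiableOn ℂ (fun w => hTilde μ₃ w - z) (halfPlane (3 * z.im / 4)) := by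
    refine ((differentiableOn_fTransform.mono fun w hw => ?_).add differentiableOn_id).sub_const z
    have hw' : 3 * z.im / 4 < w.im := hw
    change 0 < w.im
    linarith
  refine (differentiableOn_hTransform.comp h1 fun w hw => ?_).add_const z
  have := half_lt_im_hTilde_sub (μ₃ := μ₃) hz hw
  change 0 < (hTilde μ₃ w - z).im
  linarith

lemma norm_deconvMap_sub_le (h₁ : MemLp id 2 μ₁) (hz : 0 < z.im)
    (hw : w ∈ halfPlane (3 * z.im / 4)) :
    ‖deconvMap μ₁ μ₃ z w - z - ((∫ t, t ∂μ₁ : ℝ) : ℂ)‖ ≤ 2 * variance id μ₁ / z.im := by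
  have h := half_lt_im_hTilde_sub (μ₃ := μ₃) hz hw
  have hV := variance_nonneg (id : ℝ → ℝ) μ₁
  have h2 := norm_hTransform_sub_mean_le h₁ (show 0 < (hTilde μ₃ w - z).im by linarith)
  rw [deconvMap, add_sub_cancel_right]
  refine h2.trans ?_
  calc variance id μ₁ / (hTilde μ₃ w - z).im ≤ variance id μ₁ / (z.im / 2) := by gcongr
    _ = _ := by
      field_simp

lemma im_deconvMap_le (hz : 0 < z.im) (hw : w ∈ halfPlane (3 * z.im / 4)) :
    (deconvMap μ₁ μ₃ z w).im ≤ z.im := by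
  have h := half_lt_im_hTilde_sub (μ₃ := μ₃) hz hw
  have := im_hTransform_nonpos (μ := μ₁) (show 0 < (hTilde μ₃ w - z).im by linarith)
  simp [deconvMap]
  exact this

lemma le_im_deconvMap (h₁ : MemLp id 2 μ₁) (hz : 0 < z.im)
    (hw : w ∈ halfPlane (3 * z.im / 4)) :
    z.im - 2 * variance id μ₁ / z.im ≤ (deconvMap μ₁ μ₃ z w).im := by
  have h := norm_deconvMap_sub_le (μ₃ := μ₃) h₁ hz hw
  have h2 := (Complex.abs_im_le_norm _).trans h
  rw [abs_le] at h2
  simp at h2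
  linarith [h2.1]

lemma variance_div_lt {V y : ℝ} (hy : 0 < y) (hV : 8 * V < y ^ 2) : V / y < y / 8 := by
  rw [div_lt_iff₀ hy]
  linarith

/-- `T_z` maps `Im w > 3y/4`, where `y = Im z`, into the strip `7y/8 - σ²/y < Im w ≤ y`; the lower
edge is half-way between `3y/4` and the bound `y - 2σ²/y` for the range of `T_z`. -/
lemma deconvMap_mem_strip (h₁ : MemLp id 2 μ₁) (hz : 0 < z.im)
    (hV : 8 * variance id μ₁ < z.im ^ 2) :
    ∀ w ∈ halfPlane (3 * z.im / 4), 7 * z.im / 8 - variance id μ₁ / z.im <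
      (deconvMap μ₁ μ₃ z w).im ∧ (deconvMap μ₁ μ₃ z w).im ≤ z.im := by
  intro w hw
  refine ⟨?_, im_deconvMap_le hz hw⟩
  have h1 := le_im_deconvMap (μ₃ := μ₃) h₁ hz hw
  have h2 := variance_div_lt hz hV
  rw [mul_div_assoc] at h1
  linarith

lemma strip_lower_edge {V y : ℝ} (hy : 0 < y) (hV : 8 * V < y ^ 2) :
    3 * y / 4 < 7 * y / 8 - V / y := by
  linarith [variance_div_lt hy hV]

lemma self_mem_halfPlane (hz : 0 < z.im) : z ∈ halfPlane (3 * z.im / 4) := by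
  change 3 * z.im / 4 < z.im
  linarith

lemma contraction_ratio_eq {V y : ℝ} (hy : 0 < y) :
    (y - (7 * y / 8 - V / y)) / (y - 3 * y / 4) = 1 / 2 + 4 * V / y ^ 2 := by
  field_simp
  ring

lemma dist_iterate_deconvMap_succ_le (h₁ : MemLp id 2 μ₁) {s : ℝ} (hs : 0 < s)
    (hV : 8 * variance id μ₁ < s ^ 2) (hz : z ∈ halfPlane s) (n : ℕ) :
    dist ((deconvMap μ₁ μ₃ z)^[n] z) ((deconvMap μ₁ μ₃ z)^[n + 1] z) ≤
      (|∫ t, t ∂μ₁| + 2 * variance id μ₁ / s) / (1 - (1 / 2 + 4 * variance id μ₁ / s ^ 2)) *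
        (1 / 2 + 4 * variance id μ₁ / s ^ 2) ^ n := by
  have hsz : s < z.im := hz
  have hz0 : 0 < z.im := hs.trans hsz
  have hV' : 8 * variance id μ₁ < z.im ^ 2 := hV.trans (by gcongr)
  have hV0 := variance_nonneg (id : ℝ → ℝ) μ₁
  have h := dist_iterate_succ_le (differentiableOn_deconvMap (μ₁ := μ₁) (μ₃ := μ₃) hz0)
    (strip_lower_edge hz0 hV') (deconvMap_mem_strip h₁ hz0 hV') (self_mem_halfPlane hz0) rfl n
  rw [contraction_ratio_eq hz0] at h
  have hk : 1 / 2 + 4 * variance id μ₁ / z.im ^ 2 ≤ 1 / 2 + 4 * variance id μ₁ / s ^ 2 := by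
    gcongr
  have hk1 : 1 / 2 + 4 * variance id μ₁ / s ^ 2 < 1 := by
    have : 4 * variance id μ₁ / s ^ 2 < 1 / 2 := by
      rw [div_lt_iff₀ (by positivity)]
      linarith
    linarith
  have hd : ‖z - deconvMap μ₁ μ₃ z z‖ ≤ |∫ t, t ∂μ₁| + 2 * variance id μ₁ / s := by
    have h3 := norm_deconvMap_sub_le (μ₃ := μ₃) h₁ hz0 (self_mem_halfPlane hz0)
    have h4 : 2 * variance id μ₁ / z.im ≤ 2 * variance id μ₁ / s := by gcongr
    set m : ℝ := ∫ t, t ∂μ₁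
    calc ‖z - deconvMap μ₁ μ₃ z z‖ = ‖(m : ℂ) + (deconvMap μ₁ μ₃ z z - z - m)‖ := by
          rw [norm_sub_rev]
          congr 1
          ring
      _ ≤ ‖(m : ℂ)‖ + ‖deconvMap μ₁ μ₃ z z - z - m‖ := norm_add_le _ _
      _ ≤ _ := by
        rw [Complex.norm_real, Real.norm_eq_abs]
        linarith
  have hk0 : 0 < 1 / 2 + 4 * variance id μ₁ / z.im ^ 2 := by positivity
  refine h.trans ?_
  gcongr

/-- The iterates of `T_z` started at `z` converge to `ω₃(z)`. -/
lemma tendsto_iterate_deconvMap_self (h₁ : MemLp id 2 μ₁) (hz : 0 < z.im)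
    (hV : 8 * variance id μ₁ < z.im ^ 2) :
    Tendsto (fun n : ℕ => (deconvMap μ₁ μ₃ z)^[n] z) atTop (𝓝 (omega₃ μ₁ μ₃ z)) := by
  have hV0 := variance_nonneg (id : ℝ → ℝ) μ₁
  have hk1 : (z.im - (7 * z.im / 8 - variance id μ₁ / z.im)) / (z.im - 3 * z.im / 4) < 1 := by
    rw [div_lt_one (by linarith)]
    linarith [variance_div_lt hz hV]
  have hC : CauchySeq (fun n : ℕ => (deconvMap μ₁ μ₃ z)^[n] z) := cauchySeq_of_le_geometric _ _ hk1
    (dist_iterate_succ_le (differentiableOn_deconvMap (μ₁ := μ₁) (μ₃ := μ₃) hz)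
      (strip_lower_edge hz hV) (deconvMap_mem_strip h₁ hz hV) (self_mem_halfPlane hz) rfl)
  obtain ⟨l, hl⟩ := cauchySeq_tendsto_of_complete hC
  rw [omega₃, hl.limUnder_eq]
  exact hl

lemma tendsto_iterate_deconvMap (h₁ : MemLp id 2 μ₁) (hz : 0 < z.im)
    (hV : 8 * variance id μ₁ < z.im ^ 2) (hw : w ∈ halfPlane (3 * z.im / 4)) :
    Tendsto (fun n : ℕ => (deconvMap μ₁ μ₃ z)^[n] w) atTop (𝓝 (omega₃ μ₁ μ₃ z)) := by
  have h1 := tendsto_iterate_sub_iterate (differentiableOn_deconvMap (μ₁ := μ₁) (μ₃ := μ₃) hz)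
    (strip_lower_edge hz hV) (deconvMap_mem_strip h₁ hz hV) hw (self_mem_halfPlane hz)
  simpa using h1.add (tendsto_iterate_deconvMap_self (μ₃ := μ₃) h₁ hz hV)

lemma omega₃_mem_halfPlane (h₁ : MemLp id 2 μ₁) (hz : 0 < z.im)
    (hV : 8 * variance id μ₁ < z.im ^ 2) : omega₃ μ₁ μ₃ z ∈ halfPlane (3 * z.im / 4) := by
  have h := tendsto_iterate_deconvMap_self (μ₃ := μ₃) h₁ hz hV
  have h2 := (Complex.continuous_im.tendsto _).comp ((tendsto_add_atTop_iff_nat 1).2 h)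
  refine (strip_lower_edge hz hV).trans_le (ge_of_tendsto' h2 fun n => ?_)
  simp only [Function.comp_apply, Function.iterate_succ_apply']
  exact (deconvMap_mem_strip h₁ hz hV _ (iterate_mem_halfPlane (strip_lower_edge hz hV)
    (deconvMap_mem_strip h₁ hz hV) (self_mem_halfPlane hz) n)).1.le

lemma deconvMap_omega₃ (h₁ : MemLp id 2 μ₁) (hz : 0 < z.im)
    (hV : 8 * variance id μ₁ < z.im ^ 2) :
    deconvMap μ₁ μ₃ z (omega₃ μ₁ μ₃ z) = omega₃ μ₁ μ₃ z := by
  have h := tendsto_iterate_deconvMap_self (μ₃ := μ₃) h₁ hz hV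
  have hc : ContinuousAt (deconvMap μ₁ μ₃ z) (omega₃ μ₁ μ₃ z) :=
    (differentiableOn_deconvMap (μ₁ := μ₁) (μ₃ := μ₃) hz).continuousOn.continuousAt
      ((isOpen_halfPlane _).mem_nhds (omega₃_mem_halfPlane (μ₃ := μ₃) h₁ hz hV))
  have h2 := (tendsto_add_atTop_iff_nat 1).2 h
  simp only [Function.iterate_succ_apply'] at h2
  exact tendsto_nhds_unique (hc.tendsto.comp h) h2

lemma norm_omega₃_sub_le (h₁ : MemLp id 2 μ₁) (hz : 0 < z.im)
    (hV : 8 * variance id μ₁ < z.im ^ 2) :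
    ‖omega₃ μ₁ μ₃ z - z - ((∫ t, t ∂μ₁ : ℝ) : ℂ)‖ ≤ 2 * variance id μ₁ / z.im := by
  have h := norm_deconvMap_sub_le (μ₃ := μ₃) h₁ hz (omega₃_mem_halfPlane (μ₃ := μ₃) h₁ hz hV)
  rwa [deconvMap_omega₃ h₁ hz hV] at h

/-- The fixed point equation of `T_z` says that `F_{μ₃}(ω₃(z))` is also a value of `F_{μ₁}`. -/
lemma fTransform_hTilde_omega₃ (h₁ : MemLp id 2 μ₁) (hz : 0 < z.im)
    (hV : 8 * variance id μ₁ < z.im ^ 2) :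
    fTransform μ₁ (fTransform μ₃ (omega₃ μ₁ μ₃ z) + omega₃ μ₁ μ₃ z - z) =
      fTransform μ₃ (omega₃ μ₁ μ₃ z) := by
  have h := deconvMap_omega₃ (μ₃ := μ₃) h₁ hz hV
  rw [deconvMap, hTransform, hTilde] at h
  linear_combination -h

lemma differentiableAt_iterate_deconvMap (h₁ : MemLp id 2 μ₁) (hz : 0 < z.im)
    (hV : 8 * variance id μ₁ < z.im ^ 2) (n : ℕ) :
    DifferentiableAt ℂ (fun z => (deconvMap μ₁ μ₃ z)^[n] z) z := by
  induction n with
  | zero => exact differentiableAt_id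
  | succ n ih =>
    simp only [Function.iterate_succ_apply', deconvMap]
    have hmem := iterate_mem_halfPlane (strip_lower_edge hz hV)
      (deconvMap_mem_strip (μ₃ := μ₃) h₁ hz hV) (self_mem_halfPlane hz) n
    have hA := half_lt_im_hTilde_sub (μ₃ := μ₃) hz hmem
    have hmem' : 0 < ((deconvMap μ₁ μ₃ z)^[n] z).im := lt_trans (by linarith) hmem
    have d3 : DifferentiableAt ℂ (fTransform μ₃) ((deconvMap μ₁ μ₃ z)^[n] z) :=
      differentiableOn_fTransform.differentiableAt ((isOpen_halfPlane 0).mem_nhds hmem')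
    have d1 : DifferentiableAt ℂ (hTransform μ₁)
        (hTilde μ₃ ((deconvMap μ₁ μ₃ z)^[n] z) - z) :=
      differentiableOn_hTransform.differentiableAt
        ((isOpen_halfPlane 0).mem_nhds (lt_trans (half_pos hz) hA))
    have dt : DifferentiableAt ℂ (fun z => hTilde μ₃ ((deconvMap μ₁ μ₃ z)^[n] z) - z) z :=
      ((DifferentiableAt.fun_comp' (f := fun z => (deconvMap μ₁ μ₃ z)^[n] z) z d3 ih).add ih).sub
        differentiableAt_id
    exact (DifferentiableAt.fun_comp'
      (f := fun z => hTilde μ₃ ((deconvMap μ₁ μ₃ z)^[n] z) - z) z d1 dt).add differentiableAt_id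

lemma differentiableOn_omega₃ (h₁ : MemLp id 2 μ₁) {s : ℝ} (hs : 0 < s)
    (hV : 8 * variance id μ₁ < s ^ 2) : DifferentiableOn ℂ (omega₃ μ₁ μ₃) (halfPlane s) := by
  have hsz : ∀ z ∈ halfPlane s, 0 < z.im ∧ 8 * variance id μ₁ < z.im ^ 2 := by
    intro z hz
    have hz' : s < z.im := hz
    exact ⟨hs.trans hz', hV.trans (by gcongr)⟩
  have hV0 := variance_nonneg (id : ℝ → ℝ) μ₁
  set k := 1 / 2 + 4 * variance id μ₁ / s ^ 2 with hk
  have hk0 : 0 ≤ k := by positivity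
  have hk1 : k < 1 := by
    have : 4 * variance id μ₁ / s ^ 2 < 1 / 2 := by
      rw [div_lt_iff₀ (by positivity)]
      linarith
    linarith
  set C := (|∫ t, t ∂μ₁| + 2 * variance id μ₁ / s) / (1 - k) with hC
  have hunif : TendstoUniformlyOn (fun (n : ℕ) z => (deconvMap μ₁ μ₃ z)^[n] z)
      (omega₃ μ₁ μ₃) atTop (halfPlane s) := by
    rw [Metric.tendstoUniformlyOn_iff]
    intro ε hε
    have hlim : Tendsto (fun n : ℕ => C * k ^ n / (1 - k)) atTop (𝓝 0) := by
      simpa using ((tendsto_pow_atTop_nhds_zero_of_lt_one hk0 hk1).const_mul C).div_const (1 - k)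
    filter_upwards [hlim.eventually (gt_mem_nhds hε)] with n hn z hz
    rw [dist_comm]
    exact (dist_le_of_le_geometric_of_tendsto k C hk1
      (dist_iterate_deconvMap_succ_le h₁ hs hV hz)
      (tendsto_iterate_deconvMap_self h₁ (hsz z hz).1 (hsz z hz).2) n).trans_lt hn
  exact hunif.tendstoLocallyUniformlyOn.differentiableOn
    (Eventually.of_forall fun n z hz => (differentiableAt_iterate_deconvMap h₁ (hsz z hz).1
      (hsz z hz).2 n).differentiableWithinAt) (isOpen_halfPlane s)

end Subordination

/-! ### Measures recovered from their Cauchy transforms -/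

/-- A function holomorphic in the upper half-plane with quadratic decay integrates to zero along
the real line: Cauchy's theorem for the rectangles with vertices `-n`, `n`, `n + in`, `-n + in`. -/
lemma integral_real_eq_zero_of_decay {f : ℂ → ℂ} {C R : ℝ}
    (hd : DifferentiableOn ℂ f {z | 0 ≤ z.im}) (hi : Integrable fun x : ℝ => f x)
    (hb : ∀ z : ℂ, 0 ≤ z.im → R ≤ ‖z‖ → ‖f z‖ ≤ C / (1 + ‖z‖ ^ 2)) : ∫ x : ℝ, f x = 0 := by
  have hlim := intervalIntegral_tendsto_integral hi
    (tendsto_neg_atTop_atBot.comp tendsto_natCast_atTop_atTop)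
    (tendsto_natCast_atTop_atTop (R := ℝ))
  refine tendsto_nhds_unique hlim ?_
  have hC : 0 ≤ C := by
    have h := (norm_nonneg _).trans
      (hb ((|R| : ℝ) * Complex.I) (by simp) (by simpa using le_abs_self R))
    by_contra hC
    exact absurd h (not_le.2 (div_neg_of_neg_of_pos (not_le.1 hC) (by positivity)))
  refine squeeze_zero_norm' (a := fun n : ℕ => 4 * C / (n : ℝ)) ?_ ?_
  · filter_upwards [eventually_ge_atTop (max 1 ⌈R⌉₊)] with n hn
    have hn1 : (1 : ℝ) ≤ n := by exact_mod_cast (le_max_left _ _).trans hn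
    have hnR : R ≤ n := (Nat.le_ceil R).trans (by exact_mod_cast (le_max_right _ _).trans hn)
    have hside : ∀ ζ : ℂ, 0 ≤ ζ.im → (n : ℝ) ≤ ‖ζ‖ → ‖f ζ‖ ≤ C / (n : ℝ) ^ 2 := by
      intro ζ h1 h2
      refine (hb ζ h1 (hnR.trans h2)).trans ?_
      gcongr
      nlinarith [norm_nonneg ζ]
    have hrect := Complex.integral_boundary_rect_eq_zero_of_differentiableOn f
      (-(n : ℝ) : ℂ) ((n : ℝ) + (n : ℝ) * Complex.I) (hd.mono (by
        intro ζ hζ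
        have h2 : ζ.im ∈ Set.uIcc (0 : ℝ) n := by simpa using hζ.2
        rw [Set.uIcc_of_le (by positivity)] at h2
        exact h2.1))
    simp only [Complex.neg_re, Complex.ofReal_re, Complex.add_re, Complex.mul_re, Complex.I_re,
      mul_zero, Complex.ofReal_im, Complex.I_im, mul_one, sub_zero, add_zero, Complex.neg_im,
      neg_zero, Complex.ofReal_zero, zero_mul, Complex.add_im, Complex.mul_im, zero_add,
      smul_eq_mul] at hrect
    have htop : ‖∫ x : ℝ in (-(n : ℝ))..n, f (x + (n : ℝ) * Complex.I)‖ ≤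
        C / (n : ℝ) ^ 2 * |(n : ℝ) - -n| := by
      refine intervalIntegral.norm_integral_le_of_norm_le_const fun x _ => hside _ (by simp) ?_
      refine le_trans ?_ (Complex.abs_im_le_norm _)
      simp
    have hv : ∀ c : ℝ, |c| = n →
        ‖∫ y : ℝ in (0 : ℝ)..n, f (c + y * Complex.I)‖ ≤ C / (n : ℝ) ^ 2 * |(n : ℝ) - 0| := by
      intro c hc
      refine intervalIntegral.norm_integral_le_of_norm_le_const fun y hy => hside _ ?_ ?_
      · rw [Set.uIoc_of_le (by positivity)] at hy
        simpa using hy.1.le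
      · refine le_trans ?_ (Complex.abs_re_le_norm _)
        simp [hc]
    have hr := hv n (by simp)
    have hl := hv (-n) (by simp)
    push_cast at hr hl hrect
    have hI : ∀ w : ℂ, ‖Complex.I * w‖ = ‖w‖ := by simp
    have heq : ∫ x : ℝ in (-(n : ℝ))..n, f x =
        (∫ x : ℝ in (-(n : ℝ))..n, f (x + (n : ℂ) * Complex.I)) -
        Complex.I * (∫ y : ℝ in (0 : ℝ)..n, f (n + y * Complex.I)) +
        Complex.I * (∫ y : ℝ in (0 : ℝ)..n, f (-n + y * Complex.I)) := by
      linear_combination hrect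
    simp only [Function.comp_apply]
    rw [heq]
    refine ((norm_add_le _ _).trans (add_le_add (norm_sub_le _ _) le_rfl)).trans ?_
    rw [hI, hI]
    have e1 : |(n : ℝ) - -n| = 2 * n := by
      rw [sub_neg_eq_add, abs_of_nonneg (by positivity)]
      ring
    have e2 : |(n : ℝ) - 0| = n := by simp
    rw [e1] at htop
    rw [e2] at hr hl
    have e3 : 4 * C / (n : ℝ) =
        C / (n : ℝ) ^ 2 * (2 * n) + C / (n : ℝ) ^ 2 * n + C / (n : ℝ) ^ 2 * n := by
      field_simp
      ring
    rw [e3]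
    push_cast at htop
    exact add_le_add (add_le_add htop hr) hl
  · exact tendsto_const_nhds.div_atTop tendsto_natCast_atTop_atTop

lemma one_add_norm_le_mul_norm_sub {z ζ p : ℂ} {d : ℝ} (hd : 0 < d) (h : d ≤ ‖ζ - p‖)
    (hp : ‖p‖ = ‖z‖) : 1 + ‖ζ‖ ≤ ((1 + ‖z‖) / d + 1) * ‖ζ - p‖ := by
  have h1 : ‖ζ‖ ≤ ‖ζ - p‖ + ‖p‖ := by simpa using norm_add_le (ζ - p) p
  have h2 : 1 + ‖z‖ ≤ (1 + ‖z‖) / d * ‖ζ - p‖ := by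
    rw [div_mul_eq_mul_div, le_div_iff₀ hd]
    gcongr
  linarith

lemma integrable_of_norm_le_div {f : ℝ → ℂ} {C : ℝ} (hf : Continuous f)
    (hb : ∀ x, ‖f x‖ ≤ C / (1 + x ^ 2)) : Integrable f :=
  (integrable_inv_one_add_sq.const_mul C).mono' hf.aestronglyMeasurable
    (ae_of_all _ fun x => by simpa [div_eq_mul_inv] using hb x)

lemma div_le_div_one_add_sq {a C c n r : ℝ} (hn : 0 < n) (hC : 0 ≤ C) (hr : 0 ≤ r)
    (ha : a ≤ C / (1 + r)) (h : 1 + r ≤ c * n) : a / n ≤ C * c / (1 + r ^ 2) := by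
  have hr1 : 0 < 1 + r := by linarith
  have hc : 0 < c := pos_of_mul_pos_left (hr1.trans_le h) hn.le
  calc a / n ≤ C / (1 + r) / n := by gcongr
    _ ≤ C / (1 + r) / ((1 + r) / c) := by
      gcongr
      rw [div_le_iff₀ hc]
      linarith
    _ = C * c / ((1 + r) * (1 + r)) := by field_simp
    _ ≤ C * c / (1 + r ^ 2) := by
      gcongr
      nlinarith

/-- A function holomorphic in the closed upper half-plane that decays like `1 / |z|` is the Cauchy
transform of the density `-Im G / π`. -/
theorem eq_integral_neg_im_div_pi {G : ℂ → ℂ} {C : ℝ}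
    (hd : DifferentiableOn ℂ G {z | 0 ≤ z.im})
    (hb : ∀ z : ℂ, 0 ≤ z.im → ‖G z‖ ≤ C / (1 + ‖z‖)) {z : ℂ} (hz : 0 < z.im) :
    G z = ∫ x : ℝ, ((-(G x).im / Real.pi : ℝ) : ℂ) * (1 / (z - x)) := by
  have hC : 0 ≤ C := by simpa using (norm_nonneg _).trans (hb 0 (by simp))
  set zb := (starRingEnd ℂ) z with hzb
  have hzbn : ‖zb‖ = ‖z‖ := Complex.norm_conj z
  have hzbim : zb.im = -z.im := Complex.conj_im z
  -- distances to `z̄` from the closed half-plane, and to `z` from the real line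
  have hdist : ∀ ζ : ℂ, 0 ≤ ζ.im → z.im ≤ ‖ζ - zb‖ := by
    intro ζ hζ
    refine le_trans ?_ ((le_abs_self _).trans (Complex.abs_im_le_norm _))
    simp [hzbim, hζ]
  have hdistx : ∀ x : ℝ, z.im ≤ ‖(x : ℂ) - z‖ := by
    intro x
    refine le_trans ?_ (Complex.abs_im_le_norm _)
    simp [abs_of_pos hz]
  have hne : ∀ ζ : ℂ, 0 ≤ ζ.im → ζ - zb ≠ 0 := fun ζ hζ =>
    norm_pos_iff.1 (hz.trans_le (hdist ζ hζ))
  have hnex : ∀ x : ℝ, (x : ℂ) - z ≠ 0 := fun x => norm_pos_iff.1 (hz.trans_le (hdistx x))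
  set c := (1 + ‖z‖) / z.im + 1 with hc
  have hcomp : ∀ {g : ℂ → ℂ}, DifferentiableOn ℂ g {z | 0 ≤ z.im} →
      Continuous fun x : ℝ => g x := by
    intro g hg
    exact hg.continuousOn.comp_continuous Complex.continuous_ofReal fun x => by simp
  -- the reflected pole contributes nothing
  have hf₁d : DifferentiableOn ℂ (fun ζ => G ζ / (ζ - zb)) {z | 0 ≤ z.im} :=
    hd.div (by fun_prop) hne
  have hf₁b : ∀ ζ : ℂ, 0 ≤ ζ.im → ‖G ζ / (ζ - zb)‖ ≤ C * c / (1 + ‖ζ‖ ^ 2) := by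
    intro ζ hζ
    rw [norm_div]
    exact div_le_div_one_add_sq (norm_pos_iff.2 (hne ζ hζ)) hC (norm_nonneg _) (hb ζ hζ)
      (one_add_norm_le_mul_norm_sub hz (hdist ζ hζ) hzbn)
  have hf₁i : Integrable fun x : ℝ => G x / (x - zb) :=
    integrable_of_norm_le_div (hcomp hf₁d) fun x => by simpa using hf₁b x (by simp)
  have hI₁ : ∫ x : ℝ, G x / (x - zb) = 0 :=
    integral_real_eq_zero_of_decay (R := 0) hf₁d hf₁i fun ζ hζ _ => hf₁b ζ hζ
  -- subtracting a multiple of the Poisson kernel removes the pole at `z`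
  set N : ℂ → ℂ := fun ζ => G ζ - G z * (z - zb) / (ζ - zb) with hN
  have hNz : N z = 0 := by
    have := hne z hz.le
    simp only [hN]
    field_simp
    ring
  have hNd : DifferentiableOn ℂ N {z | 0 ≤ z.im} :=
    hd.sub ((differentiableOn_const _).div (by fun_prop) hne)
  set C' := C + ‖G z * (z - zb)‖ * c with hC'
  have hc0 : 0 ≤ c := by positivity
  have hC'0 : 0 ≤ C' := by positivity
  have hNb : ∀ ζ : ℂ, 0 ≤ ζ.im → ‖N ζ‖ ≤ C' / (1 + ‖ζ‖) := by
    intro ζ hζ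
    have h1 : 0 < 1 + ‖ζ‖ := by positivity
    have h2 : 1 / ‖ζ - zb‖ ≤ c / (1 + ‖ζ‖) := by
      rw [div_le_div_iff₀ (norm_pos_iff.2 (hne ζ hζ)) h1, one_mul]
      exact one_add_norm_le_mul_norm_sub hz (hdist ζ hζ) hzbn
    calc ‖N ζ‖ ≤ ‖G ζ‖ + ‖G z * (z - zb) / (ζ - zb)‖ := norm_sub_le _ _
      _ = ‖G ζ‖ + ‖G z * (z - zb)‖ * (1 / ‖ζ - zb‖) := by
        rw [norm_div (G z * (z - zb))]
        ring
      _ ≤ C / (1 + ‖ζ‖) + ‖G z * (z - zb)‖ * (c / (1 + ‖ζ‖)) := by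
        gcongr
        exact hb ζ hζ
      _ = _ := by
        rw [hC']
        ring
  have hmem : {z : ℂ | 0 ≤ z.im} ∈ 𝓝 z :=
    mem_of_superset ((isOpen_halfPlane 0).mem_nhds hz) fun w hw =>
      (show 0 < w.im from hw).le
  have hf₂d : DifferentiableOn ℂ (dslope N z) {z | 0 ≤ z.im} :=
    (Complex.differentiableOn_dslope hmem).2 hNd
  have hf₂e : ∀ ζ : ℂ, ζ ≠ z → dslope N z ζ = N ζ / (ζ - z) := by
    intro ζ hζ
    rw [dslope_of_ne _ hζ, slope_def_field, hNz, sub_zero]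
  have hxz : ∀ x : ℝ, (x : ℂ) ≠ z := fun x => sub_ne_zero.1 (hnex x)
  have hf₂i : Integrable fun x : ℝ => dslope N z x := by
    refine integrable_of_norm_le_div (C := C' * c) (hcomp hf₂d) fun x => ?_
    rw [hf₂e _ (hxz x), norm_div]
    have := div_le_div_one_add_sq (norm_pos_iff.2 (hnex x)) hC'0 (norm_nonneg _)
      (hNb x (by simp)) (one_add_norm_le_mul_norm_sub hz (hdistx x) rfl)
    simpa using this
  have hI₂ : ∫ x : ℝ, dslope N z x = 0 := by
    refine integral_real_eq_zero_of_decay (C := C' * 2) (R := 2 * ‖z‖ + 1) hf₂d hf₂i ?_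
    intro ζ hζ hR
    have h1 : ‖ζ‖ ≤ ‖ζ - z‖ + ‖z‖ := by simpa using norm_add_le (ζ - z) z
    have h0 := norm_nonneg z
    have h2 : 0 < ‖ζ - z‖ := by linarith
    rw [hf₂e _ (sub_ne_zero.1 (norm_pos_iff.1 h2)), norm_div]
    exact div_le_div_one_add_sq h2 hC'0 (norm_nonneg _) (hNb ζ hζ) (by linarith)
  -- the Poisson kernel has integral one
  obtain ⟨γ, hγz⟩ : ∃ γ : ℝ≥0, (γ : ℝ) = z.im := ⟨⟨z.im, hz.le⟩, rfl⟩
  have hγ : γ ≠ 0 := by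
    rintro rfl
    exact hz.ne hγz
  have hPi : Integrable fun x : ℝ => ((cauchyPDFReal z.re γ x : ℝ) : ℂ) :=
    (integrable_cauchyPDFReal z.re).ofReal
  have hP : ∫ x : ℝ, ((cauchyPDFReal z.re γ x : ℝ) : ℂ) = 1 := by
    rw [integral_complex_ofReal, integral_cauchyPDFReal_eq_one _ hγ, Complex.ofReal_one]
  have hπ : (Real.pi : ℂ) ≠ 0 := by exact_mod_cast Real.pi_ne_zero
  have hzz : z - zb = 2 * z.im * Complex.I := by
    rw [hzb, Complex.sub_conj]
    push_cast
    ring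
  have hPe : ∀ x : ℝ, ((cauchyPDFReal z.re γ x : ℝ) : ℂ) =
      z.im / Real.pi / ((x - zb) * (x - z)) := by
    intro x
    have h1 : ((x : ℂ) - zb) * (x - z) = (((x - z.re) ^ 2 + z.im ^ 2 : ℝ) : ℂ) := by
      apply Complex.ext
      · simp [hzb, pow_two]
      · simp [hzb, pow_two]
        ring
    rw [h1, cauchyPDFReal_def, hγz]
    push_cast
    rw [div_eq_mul_inv, div_eq_mul_inv, mul_comm ((Real.pi : ℂ)⁻¹)]
  have hconj : ∀ x : ℝ, (starRingEnd ℂ) (G x / (x - zb)) = (starRingEnd ℂ) (G x) / (x - z) := by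
    intro x
    simp [hzb]
  have hpt : ∀ x : ℝ, ((-(G x).im / Real.pi : ℝ) : ℂ) * (1 / (z - x)) =
      1 / (2 * Real.pi * Complex.I) * (dslope N z x - (starRingEnd ℂ) (G x / (x - zb))) +
        G z * ((cauchyPDFReal z.re γ x : ℝ) : ℂ) := by
    intro x
    have h1 := hnex x
    have h2 := hne x (by simp)
    have h3 : z - (x : ℂ) = -(x - z) := by ring
    have h4 : (((G x).im : ℝ) : ℂ) = (G x - (starRingEnd ℂ) (G x)) / (2 * Complex.I) := by
      rw [Complex.sub_conj]
      field_simp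
      push_cast
      ring
    rw [hPe, hconj, hf₂e _ (hxz x), h3]
    simp only [hN]
    rw [hzz]
    push_cast
    rw [h4]
    generalize (starRingEnd ℂ) (G x) = g
    field_simp
    ring
  have hconji : Integrable fun x : ℝ => (starRingEnd ℂ) (G x / (x - zb)) :=
    Complex.conjLIE.toContinuousLinearEquiv.toContinuousLinearMap.integrable_comp hf₁i
  have hsub : Integrable fun x : ℝ => 1 / (2 * Real.pi * Complex.I) *
      (dslope N z x - (starRingEnd ℂ) (G x / (x - zb))) := (hf₂i.sub hconji).const_mul _
  simp_rw [hpt]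
  rw [integral_add hsub (hPi.const_mul _), integral_const_mul,
    integral_const_mul, integral_sub hf₂i hconji, hI₂, integral_conj, hI₁, hP]
  simp

lemma integral_withDensity_ofReal {p : ℝ → ℝ} (hp : Measurable p) (hp0 : ∀ x, 0 ≤ p x)
    (g : ℝ → ℂ) :
    ∫ x, g x ∂(volume.withDensity fun x => ENNReal.ofReal (p x)) = ∫ x, (p x : ℂ) * g x := by
  rw [integral_withDensity_eq_integral_toReal_smul (by fun_prop)
    (ae_of_all _ fun x => ENNReal.ofReal_lt_top)]
  congr 1
  ext x
  rw [ENNReal.toReal_ofReal (hp0 x), Complex.real_smul]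

/-- A density whose Cauchy transform `G` satisfies `iy G(iy) → 1` as `y → ∞` has mass one. -/
lemma integral_eq_one_of_tendsto {p : ℝ → ℝ} (hp0 : ∀ x, 0 ≤ p x) (hpi : Integrable p)
    (h : Tendsto (fun n : ℕ => (((n : ℝ) + 1 : ℝ) * Complex.I) *
      ∫ x : ℝ, (p x : ℂ) * (1 / (((n : ℝ) + 1 : ℝ) * Complex.I - x))) atTop (𝓝 1)) :
    ∫ x, p x = 1 := by
  set y : ℕ → ℂ := fun n => ((n : ℝ) + 1 : ℝ) * Complex.I with hy
  have hyim : ∀ n, (y n).im = n + 1 := by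
    intro n
    simp [hy]
  have hypos : ∀ n, 0 < (y n).im := by
    intro n
    rw [hyim]
    positivity
  have hynorm : ∀ n, ‖y n‖ = (y n).im := by
    intro n
    have h0 : (0 : ℝ) ≤ n + 1 := by positivity
    rw [hyim, hy, norm_mul, Complex.norm_real, Complex.norm_I, mul_one, Real.norm_of_nonneg h0]
  have hlim : Tendsto (fun n => ∫ x : ℝ, y n * ((p x : ℂ) * (1 / (y n - x)))) atTop
      (𝓝 (∫ x : ℝ, (p x : ℂ))) := by
    refine tendsto_integral_of_dominated_convergence p (fun n => ?_) hpi (fun n => ?_) ?_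
    · exact ((hpi.ofReal.aestronglyMeasurable).mul
        (continuous_one_div_sub (hypos n)).aestronglyMeasurable).const_mul _
    · refine ae_of_all _ fun x => ?_
      rw [norm_mul (y n), norm_mul (p x : ℂ), hynorm, Complex.norm_real, Real.norm_of_nonneg (hp0 x)]
      have h1 := norm_one_div_sub_le (hypos n) x
      have h2 := hypos n
      have h3 := hp0 x
      calc (y n).im * (p x * ‖1 / (y n - x)‖) ≤ (y n).im * (p x * (1 / (y n).im)) := by gcongr
        _ = p x := by field_simp
    · refine ae_of_all _ fun x => ?_
      have hinv : Tendsto (fun n => (x : ℂ) / y n) atTop (𝓝 0) := by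
        rw [tendsto_zero_iff_norm_tendsto_zero]
        simp_rw [norm_div, hynorm, hyim]
        exact tendsto_const_nhds.div_atTop
          (tendsto_natCast_atTop_atTop.atTop_add tendsto_const_nhds)
      have h2 : Tendsto (fun n => (p x : ℂ) * (1 / (1 - (x : ℂ) / y n))) atTop (𝓝 (p x)) := by
        have h3 : Tendsto (fun n => 1 - (x : ℂ) / y n) atTop (𝓝 1) := by
          simpa using tendsto_const_nhds.sub hinv
        have h4 := (tendsto_const_nhds (x := (1 : ℂ))).div h3 one_ne_zero
        simpa using h4.const_mul (p x : ℂ)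
      refine h2.congr fun n => ?_
      have h4 : y n ≠ 0 := by
        intro h0
        have := hypos n
        simp [h0] at this
      have h5 := sub_ofReal_ne_zero (hypos n) x
      have h6 : 1 - (x : ℂ) / y n ≠ 0 := by
        rw [one_sub_div h4]
        exact div_ne_zero h5 h4
      field_simp
  simp_rw [integral_const_mul] at hlim
  have h7 := tendsto_nhds_unique hlim h
  rw [integral_complex_ofReal] at h7
  exact_mod_cast h7

lemma tendsto_I_mul_div {F : ℂ → ℂ} {K : ℝ} (hF : ∀ z ∈ halfPlane 0, ‖F z - z‖ ≤ K) :
    Tendsto (fun n : ℕ => ((((n : ℝ) + 1 : ℝ) : ℂ) * Complex.I) *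
      (1 / F ((((n : ℝ) + 1 : ℝ) : ℂ) * Complex.I))) atTop (𝓝 1) := by
  set y : ℕ → ℂ := fun n => (((n : ℝ) + 1 : ℝ) : ℂ) * Complex.I with hy
  have hynorm : ∀ n, ‖y n‖ = n + 1 := by
    intro n
    have h0 : (0 : ℝ) ≤ n + 1 := by positivity
    rw [hy, norm_mul, Complex.norm_real, Complex.norm_I, mul_one, Real.norm_of_nonneg h0]
  have hym : ∀ n, y n ∈ halfPlane 0 := by
    intro n
    have h0 : (0 : ℝ) < n + 1 := by positivity
    simpa [hy, halfPlane] using h0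
  have hquot : Tendsto (fun n => (F (y n) - y n) / y n) atTop (𝓝 0) := by
    refine squeeze_zero_norm (a := fun n : ℕ => K / ((n : ℝ) + 1)) (fun n => ?_) ?_
    · rw [norm_div, hynorm]
      have := hF _ (hym n)
      gcongr
    · exact tendsto_const_nhds.div_atTop
        (tendsto_natCast_atTop_atTop.atTop_add tendsto_const_nhds)
  have h3 : Tendsto (fun n => 1 + (F (y n) - y n) / y n) atTop (𝓝 1) := by
    simpa using tendsto_const_nhds.add hquot
  have h4 := (tendsto_const_nhds (x := (1 : ℂ))).div h3 one_ne_zero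
  rw [div_one] at h4
  refine h4.congr fun n => ?_
  have h5 : y n ≠ 0 := by
    rw [← norm_pos_iff, hynorm]
    positivity
  have h6 : 1 + (F (y n) - y n) / y n = F (y n) / y n := by
    field_simp
    ring
  simp only [Pi.div_apply]
  rw [h6, one_div_div, mul_one_div]

/-- A function that is holomorphic in the closed upper half-plane, at bounded distance from the
identity and with imaginary part bounded below there, is the `F`-transform of a probability measure
whose density is at most an explicit multiple of `1 / (1 + x ^ 2)`. -/
theorem exists_density_of_closedHalfPlane {F : ℂ → ℂ} {K δ : ℝ} (hδ : 0 < δ)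
    (hd : DifferentiableOn ℂ F {z | 0 ≤ z.im}) (hK : ∀ z : ℂ, 0 ≤ z.im → ‖F z - z‖ ≤ K)
    (him : ∀ z : ℂ, 0 ≤ z.im → δ ≤ (F z).im) :
    ∃ μ : Measure ℝ, IsProbabilityMeasure μ ∧
      μ ≤ volume.withDensity
        (fun x => ENNReal.ofReal (K * ((1 + K) / δ + 1) ^ 2 * (1 + x ^ 2)⁻¹)) ∧
      ∀ z : ℂ, 0 < z.im → cauchyTransform μ z = 1 / F z := by
  have hK0 : 0 ≤ K := (norm_nonneg _).trans (hK 0 (by simp))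
  set C := (1 + K) / δ + 1 with hC
  have hC0 : 0 < C := by positivity
  have hFδ : ∀ z : ℂ, 0 ≤ z.im → δ ≤ ‖F z‖ := fun z hz =>
    (him z hz).trans ((le_abs_self _).trans (Complex.abs_im_le_norm _))
  have hF0 : ∀ z : ℂ, 0 ≤ z.im → F z ≠ 0 := fun z hz =>
    norm_pos_iff.1 (hδ.trans_le (hFδ z hz))
  have hFlow : ∀ z : ℂ, 0 ≤ z.im → 1 + ‖z‖ ≤ C * ‖F z‖ := by
    intro z hz
    have h1 : ‖z‖ ≤ ‖F z‖ + K := by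
      have h2 := norm_sub_le (F z) (F z - z)
      rw [sub_sub_cancel] at h2
      linarith [hK z hz]
    have h3 : 1 + K ≤ (1 + K) / δ * ‖F z‖ := by
      rw [div_mul_eq_mul_div, le_div_iff₀ hδ]
      have := hFδ z hz
      gcongr
    rw [hC]
    linarith
  set G : ℂ → ℂ := fun z => 1 / F z with hG
  have hGd : DifferentiableOn ℂ G {z | 0 ≤ z.im} := (differentiableOn_const 1).div hd hF0
  have hGb : ∀ z : ℂ, 0 ≤ z.im → ‖G z‖ ≤ C / (1 + ‖z‖) := by
    intro z hz
    rw [hG, norm_div, norm_one, div_le_div_iff₀ (norm_pos_iff.2 (hF0 z hz)) (by positivity),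
      one_mul]
    exact hFlow z hz
  set p : ℝ → ℝ := fun x => -(G x).im / Real.pi with hp
  have hpim : ∀ x : ℝ, -(G x).im = (F x).im / ‖F x‖ ^ 2 := by
    intro x
    change -(1 / F x).im = _
    rw [one_div, Complex.inv_im, Complex.normSq_eq_norm_sq]
    ring
  have hFim : ∀ x : ℝ, 0 < (F x).im := fun x => hδ.trans_le (him x (by simp))
  have hp0 : ∀ x, 0 ≤ p x := by
    intro x
    simp only [hp, hpim]
    have := hFim x
    positivity
  have hpc : Continuous p := by
    have : Continuous fun x : ℝ => G x :=
      hGd.continuousOn.comp_continuous Complex.continuous_ofReal fun x => by simp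
    exact (Complex.continuous_im.comp this).neg.div_const _
  have hpb : ∀ x, p x ≤ K * C ^ 2 * (1 + x ^ 2)⁻¹ := by
    intro x
    have h1 : (F x).im ≤ K := by
      have := (le_abs_self _).trans ((Complex.abs_im_le_norm _).trans (hK x (by simp)))
      simpa using this
    have h2 := hFlow x (by simp)
    have h3 : 0 < ‖F x‖ := norm_pos_iff.2 (hF0 x (by simp))
    have h4 : 1 + x ^ 2 ≤ C ^ 2 * ‖F x‖ ^ 2 := by
      have h5 := pow_le_pow_left₀ (by positivity) h2 2
      have h6 : ‖(x : ℂ)‖ ^ 2 = x ^ 2 := by simp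
      rw [mul_pow] at h5
      nlinarith [norm_nonneg (x : ℂ)]
    have h7 := Real.pi_gt_three
    simp only [hp, hpim]
    calc (F x).im / ‖F x‖ ^ 2 / Real.pi ≤ (F x).im / ‖F x‖ ^ 2 / 1 := by
          have := hFim x
          gcongr
          linarith
      _ ≤ K / ‖F x‖ ^ 2 := by
        rw [div_one]
        gcongr
      _ ≤ K * C ^ 2 * (1 + x ^ 2)⁻¹ := by
        rw [← div_eq_mul_inv, div_le_div_iff₀ (by positivity) (by positivity)]
        nlinarith
  have hpi : Integrable p := by
    refine (integrable_inv_one_add_sq.const_mul (K * C ^ 2)).mono' hpc.aestronglyMeasurable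
      (ae_of_all _ fun x => ?_)
    rw [Real.norm_of_nonneg (hp0 x)]
    exact hpb x
  have hrep : ∀ z : ℂ, 0 < z.im → ∫ x : ℝ, (p x : ℂ) * (1 / (z - x)) = 1 / F z := fun z hz =>
    (eq_integral_neg_im_div_pi hGd hGb hz).symm
  have hmass : ∫ x, p x = 1 := by
    refine integral_eq_one_of_tendsto hp0 hpi ?_
    refine (tendsto_I_mul_div fun z hz => hK z (le_of_lt hz)).congr fun n => ?_
    rw [hrep _ (by
      have h0 : (0 : ℝ) < n + 1 := by positivity
      simpa using h0)]
  refine ⟨volume.withDensity fun x => ENNReal.ofReal (p x), ⟨?_⟩, ?_, fun z hz => ?_⟩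
  · rw [withDensity_apply _ MeasurableSet.univ, Measure.restrict_univ,
      ← ofReal_integral_eq_lintegral_ofReal hpi (ae_of_all _ hp0), hmass, ENNReal.ofReal_one]
  · exact withDensity_mono (ae_of_all _ fun x => ENNReal.ofReal_le_ofReal (hpb x))
  · rw [cauchyTransform, integral_withDensity_ofReal hpc.measurable hp0]
    exact hrep z hz

/-- A special case of the Nevanlinna representation theorem. The measures attached to the shifts
`z ↦ F (z + i / (n + 1))`, which are holomorphic across the real line, are tight because their
densities have a common integrable bound, and any limit point has `F`-transform `F`. -/
theorem exists_fTransform_eq {F : ℂ → ℂ} {K δ : ℝ} (hδ : 0 < δ)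
    (hd : DifferentiableOn ℂ F (halfPlane 0)) (hK : ∀ z ∈ halfPlane 0, ‖F z - z‖ ≤ K)
    (him : ∀ z ∈ halfPlane 0, δ ≤ (F z).im) :
    ∃ μ : Measure ℝ, IsProbabilityMeasure μ ∧ ∀ z ∈ halfPlane 0, F z = fTransform μ z := by
  set ε : ℕ → ℝ := fun n => 1 / ((n : ℝ) + 1) with hε
  have hε0 : ∀ n, 0 < ε n := fun n => Nat.one_div_pos_of_nat
  have hε1 : ∀ n, ε n ≤ 1 := by
    intro n
    rw [hε]
    apply div_le_one_of_le₀ <;> linarith [(Nat.cast_nonneg n : (0 : ℝ) ≤ n)]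
  have hshift : ∀ n, ∀ z : ℂ, 0 ≤ z.im → z + ε n * Complex.I ∈ halfPlane 0 := by
    intro n z hz
    have := hε0 n
    change 0 < (z + ε n * Complex.I).im
    simp
    linarith
  have hex := fun n => exists_density_of_closedHalfPlane (F := fun z => F (z + ε n * Complex.I))
    (K := K + 1) hδ
    (hd.comp (by fun_prop) (hshift n)) (fun z hz => by
      calc ‖F (z + ε n * Complex.I) - z‖
          = ‖(F (z + ε n * Complex.I) - (z + ε n * Complex.I)) + ε n * Complex.I‖ := by
            congr 1
            ring
        _ ≤ ‖F (z + ε n * Complex.I) - (z + ε n * Complex.I)‖ + ‖ε n * Complex.I‖ :=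
            norm_add_le _ _
        _ ≤ K + 1 := by
          refine add_le_add (hK _ (hshift n z hz)) ?_
          rw [norm_mul, Complex.norm_I, mul_one, Complex.norm_real,
            Real.norm_of_nonneg (hε0 n).le]
          exact hε1 n)
    (fun z hz => him _ (hshift n z hz))
  choose m hmp hmle hmG using hex
  set ν : Measure ℝ := volume.withDensity
    (fun x => ENNReal.ofReal ((K + 1) * ((1 + (K + 1)) / δ + 1) ^ 2 * (1 + x ^ 2)⁻¹)) with hν
  have hνf : IsFiniteMeasure ν :=
    isFiniteMeasure_withDensity_ofReal
      (integrable_inv_one_add_sq.const_mul ((K + 1) * ((1 + (K + 1)) / δ + 1) ^ 2)).2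
  set P : ℕ → ProbabilityMeasure ℝ := fun n => ⟨m n, hmp n⟩ with hP
  have htight : IsTightMeasureSet {((μ : ProbabilityMeasure ℝ) : Measure ℝ) | μ ∈ Set.range P} := by
    rw [isTightMeasureSet_iff_exists_isCompact_measure_compl_le]
    intro η hη
    obtain ⟨A, hA, hA2⟩ := isTightMeasureSet_iff_exists_isCompact_measure_compl_le.1
      (isTightMeasureSet_singleton (μ := ν)) η hη
    refine ⟨A, hA, ?_⟩
    rintro _ ⟨_, ⟨n, rfl⟩, rfl⟩
    exact (hmle n _).trans (hA2 ν rfl)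
  have hcpt := isCompact_closure_of_isTightMeasureSet htight
  obtain ⟨μ, -, hμ⟩ := hcpt.ultrafilter_le_nhds ((Ultrafilter.of atTop).map P) (by
    rw [le_principal_iff, Ultrafilter.mem_coe, Ultrafilter.mem_map]
    exact univ_mem' fun n => subset_closure (Set.mem_range_self n))
  have hlim : Tendsto P (Ultrafilter.of atTop : Ultrafilter ℕ) (𝓝 μ) := hμ
  rw [ProbabilityMeasure.tendsto_iff_forall_integral_rclike_tendsto ℂ] at hlim
  refine ⟨μ, inferInstance, fun z hz => ?_⟩
  have hz' : 0 < z.im := hz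
  have h1 := hlim (BoundedContinuousFunction.ofNormedAddCommGroup _ (continuous_one_div_sub hz')
    (1 / z.im) (norm_one_div_sub_le hz'))
  have h2 : Tendsto (fun n => 1 / F (z + ε n * Complex.I))
      (Ultrafilter.of atTop : Ultrafilter ℕ) (𝓝 (cauchyTransform μ z)) :=
    h1.congr fun n => hmG n z hz'
  have hFz : F z ≠ 0 := by
    intro h0
    have := him z hz
    rw [h0] at this
    exact absurd this (not_le.2 (by simpa using hδ))
  have h3 : Tendsto (fun n => 1 / F (z + ε n * Complex.I)) atTop (𝓝 (1 / F z)) := by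
    have hc : ContinuousAt F z := hd.continuousOn.continuousAt ((isOpen_halfPlane 0).mem_nhds hz)
    have hz1 : Tendsto (fun n => z + ε n * Complex.I) atTop (𝓝 z) := by
      have h4 : Tendsto (fun n => (ε n : ℂ)) atTop (𝓝 ((0 : ℝ) : ℂ)) :=
        (Complex.continuous_ofReal.tendsto _).comp tendsto_one_div_add_atTop_nhds_zero_nat
      simpa using tendsto_const_nhds.add (h4.mul_const Complex.I)
    exact tendsto_const_nhds.div (hc.tendsto.comp hz1) hFz
  have h5 := tendsto_nhds_unique h2 (h3.mono_left (Ultrafilter.of_le atTop))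
  rw [fTransform, h5, one_div_one_div]

/-! ### Inverses of maps close to the identity and Voiculescu transforms -/

/-- A holomorphic map at bounded distance `K` from the identity on `Im z > s` differs from it by a
`1/2`-Lipschitz map on `Im z > s + 2 K`. -/
lemma norm_sub_sub_sub_le_half {F : ℂ → ℂ} {K s : ℝ} (hK : 0 < K)
    (hd : DifferentiableOn ℂ F (halfPlane s)) (hb : ∀ z ∈ halfPlane s, ‖F z - z‖ ≤ K) :
    (∀ u ∈ halfPlane (s + 2 * K), ‖deriv (fun z => F z - z) u‖ ≤ 1 / 2) ∧
    ∀ u ∈ halfPlane (s + 2 * K), ∀ v ∈ halfPlane (s + 2 * K),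
      ‖(F u - u) - (F v - v)‖ ≤ 1 / 2 * ‖u - v‖ := by
  have hgd : DifferentiableOn ℂ (fun z => F z - z) (halfPlane s) := hd.sub differentiableOn_id
  have hder : ∀ u ∈ halfPlane (s + 2 * K), ‖deriv (fun z => F z - z) u‖ ≤ 1 / 2 := by
    intro u hu
    have hsub : Metric.closedBall u (2 * K) ⊆ halfPlane s := by
      intro w hw
      rw [mem_closedBall_iff_norm] at hw
      have h1 := (abs_le.1 ((Complex.abs_im_le_norm (w - u)).trans hw)).1
      rw [Complex.sub_im] at h1
      have h2 : s + 2 * K < u.im := hu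
      change s < w.im
      linarith
    have h := Complex.norm_deriv_le_of_forall_mem_sphere_norm_le (f := fun z => F z - z)
      (c := u) (R := 2 * K) (C := K) (by positivity)
      ((hgd.mono hsub).diffContOnCl_ball subset_rfl)
      (fun w hw => hb w (hsub (Metric.sphere_subset_closedBall hw)))
    refine h.trans_eq ?_
    field_simp
  refine ⟨hder, fun u hu v hv => ?_⟩
  have hsub : halfPlane (s + 2 * K) ⊆ halfPlane s := fun w hw =>
    lt_trans (by linarith) (show s + 2 * K < w.im from hw)
  have hconv : Convex ℝ (halfPlane (s + 2 * K)) := convex_halfSpace_im_gt _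
  exact hconv.norm_image_sub_le_of_norm_deriv_le (f := fun z => F z - z)
    (fun w hw => hgd.differentiableAt ((isOpen_halfPlane s).mem_nhds (hsub hw))) hder hv hu

/-- A holomorphic map at bounded distance from the identity on a half-plane has a holomorphic right
inverse on a smaller half-plane, by Banach's fixed point theorem for `w ↦ z - (F w - w)`. -/
theorem exists_rightInverse {F : ℂ → ℂ} {K s : ℝ} (hK : 0 < K)
    (hd : DifferentiableOn ℂ F (halfPlane s)) (hb : ∀ z ∈ halfPlane s, ‖F z - z‖ ≤ K) :
    ∃ ψ : ℂ → ℂ, DifferentiableOn ℂ ψ (halfPlane (s + 3 * K)) ∧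
      ∀ z ∈ halfPlane (s + 3 * K), ‖ψ z - z‖ ≤ K ∧ F (ψ z) = z ∧
        ∀ w ∈ halfPlane (s + 2 * K), F w = z → w = ψ z := by
  obtain ⟨hder, hlip⟩ := norm_sub_sub_sub_le_half hK hd hb
  have hsub : halfPlane (s + 2 * K) ⊆ halfPlane s := fun w hw =>
    lt_trans (by linarith) (show s + 2 * K < w.im from hw)
  have hball : ∀ z ∈ halfPlane (s + 3 * K), Metric.closedBall z K ⊆ halfPlane (s + 2 * K) := by
    intro z hz w hw
    rw [mem_closedBall_iff_norm] at hw
    have h1 := (abs_le.1 ((Complex.abs_im_le_norm (w - z)).trans hw)).1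
    rw [Complex.sub_im] at h1
    have h2 : s + 3 * K < z.im := hz
    change s + 2 * K < w.im
    linarith
  have hex : ∀ z ∈ halfPlane (s + 3 * K), ∃ w ∈ Metric.closedBall z K, F w = z := by
    intro z hz
    have hmaps : Set.MapsTo (fun w => z - (F w - w)) (Metric.closedBall z K)
        (Metric.closedBall z K) := by
      intro w hw
      rw [mem_closedBall_iff_norm, sub_sub_cancel_left, norm_neg]
      exact hb w (hsub (hball z hz hw))
    have hcontr : ContractingWith (1 / 2) (hmaps.restrict _ _ _) := by
      refine ⟨by
        rw [← NNReal.coe_lt_coe]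
        norm_num, LipschitzWith.of_dist_le_mul ?_⟩
      rintro ⟨u, hu⟩ ⟨v, hv⟩
      rw [Subtype.dist_eq, Subtype.dist_eq, dist_eq_norm, dist_eq_norm]
      simp only [Set.MapsTo.val_restrict_apply]
      rw [sub_sub_sub_cancel_left, norm_sub_rev]
      simpa using hlip u (hball z hz hu) v (hball z hz hv)
    obtain ⟨w, hw, hfix, -⟩ := ContractingWith.exists_fixedPoint'
      Metric.isClosed_closedBall.isComplete
      hmaps hcontr (Metric.mem_closedBall_self hK.le) (edist_ne_top _ _)
    refine ⟨w, hw, ?_⟩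
    have h3 : z - (F w - w) = w := hfix
    linear_combination -h3
  choose! ψ hψball hψ using hex
  have huniq : ∀ z ∈ halfPlane (s + 3 * K), ∀ w ∈ halfPlane (s + 2 * K), F w = z → w = ψ z := by
    intro z hz w hw hwz
    have h1 := hlip w hw _ (hball z hz (hψball z hz))
    rw [hwz, hψ z hz] at h1
    have h2 : z - w - (z - ψ z) = -(w - ψ z) := by ring
    rw [h2, norm_neg] at h1
    have h3 : ‖w - ψ z‖ = 0 := by linarith [norm_nonneg (w - ψ z)]
    exact sub_eq_zero.1 (norm_eq_zero.1 h3)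
  have hψlip : ∀ z ∈ halfPlane (s + 3 * K), ∀ z' ∈ halfPlane (s + 3 * K),
      ‖ψ z' - ψ z‖ ≤ 2 * ‖z' - z‖ := by
    intro z hz z' hz'
    have h1 := hlip _ (hball z' hz' (hψball z' hz')) _ (hball z hz (hψball z hz))
    rw [hψ z hz, hψ z' hz'] at h1
    have h2 : ψ z' - ψ z = (z' - z) - ((z' - ψ z') - (z - ψ z)) := by ring
    have h3 := norm_sub_le (z' - z) ((z' - ψ z') - (z - ψ z))
    rw [← h2] at h3
    linarith
  refine ⟨ψ, fun z hz => ?_, fun z hz =>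
    ⟨mem_closedBall_iff_norm.1 (hψball z hz), hψ z hz, huniq z hz⟩⟩
  have hnhds : halfPlane (s + 3 * K) ∈ 𝓝 z := (isOpen_halfPlane _).mem_nhds hz
  have hcont : ContinuousAt ψ z := by
    rw [ContinuousAt, tendsto_iff_norm_sub_tendsto_zero]
    have h4 : Tendsto (fun z' => 2 * ‖z' - z‖) (𝓝 z) (𝓝 0) := by
      have : Continuous fun z' : ℂ => 2 * ‖z' - z‖ := by fun_prop
      simpa using this.tendsto z
    refine squeeze_zero' (Eventually.of_forall fun _ => norm_nonneg _) ?_ h4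
    filter_upwards [hnhds] with z' hz' using hψlip z hz z' hz'
  have hmem := hball z hz (hψball z hz)
  have hdF : DifferentiableAt ℂ F (ψ z) :=
    hd.differentiableAt ((isOpen_halfPlane s).mem_nhds (hsub hmem))
  have hne : deriv F (ψ z) ≠ 0 := by
    intro h0
    have h5 := hder _ hmem
    have h6 : deriv (fun z => F z - z) (ψ z) = deriv F (ψ z) - 1 := by
      have := (hdF.hasDerivAt.sub (hasDerivAt_id (ψ z))).deriv
      exact this
    rw [h6, h0] at h5
    norm_num at h5
  have h7 := HasDerivAt.of_local_left_inverse hcont hdF.hasDerivAt hne (by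
    filter_upwards [hnhds] with z' hz' using hψ z' hz')
  exact h7.differentiableAt.differentiableWithinAt

lemma isVoiculescuTransformOn_of_rightInverse {μ : Measure ℝ} {ψ : ℂ → ℂ} {K s : ℝ} {α β : ℝ}
    (hKs : K ≤ s) (hsβ : s ≤ β) (hd : DifferentiableOn ℂ ψ (halfPlane s))
    (hψ : ∀ z ∈ halfPlane s, ‖ψ z - z‖ ≤ K ∧ fTransform μ (ψ z) = z) :
    IsVoiculescuTransformOn μ α β (fun z => ψ z - z) := by
  have hcone : ∀ z ∈ truncCone α β, z ∈ halfPlane s := fun z hz => hsβ.trans_lt hz.1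
  constructor
  · intro z hz
    exact (hd.sub differentiableOn_id).analyticAt ((isOpen_halfPlane s).mem_nhds (hcone z hz))
  · intro z hz
    have h1 := (hψ z (hcone z hz)).1
    have h2 := (abs_le.1 ((Complex.abs_im_le_norm (ψ z - z)).trans h1)).1
    rw [Complex.sub_im] at h2
    have h3 : s < z.im := hcone z hz
    rw [add_sub_cancel]
    change 0 < (ψ z).im
    linarith
  · intro z hz
    rw [add_sub_cancel]
    exact (hψ z (hcone z hz)).2
  · have hnorm : Tendsto (fun z : ℂ => K / ‖z‖) (Bornology.cobounded ℂ ⊓ 𝓟 (truncCone α β))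
        (𝓝 0) :=
      (tendsto_const_nhds.div_atTop tendsto_norm_cobounded_atTop).mono_left inf_le_left
    rw [tendsto_iff_norm_sub_tendsto_zero]
    refine squeeze_zero' (Eventually.of_forall fun _ => norm_nonneg _) ?_ hnorm
    have hne : ∀ᶠ z : ℂ in Bornology.cobounded ℂ ⊓ 𝓟 (truncCone α β), z ≠ 0 :=
      (Bornology.eventually_ne_cobounded 0).filter_mono inf_le_left
    have hin : ∀ᶠ z : ℂ in Bornology.cobounded ℂ ⊓ 𝓟 (truncCone α β), z ∈ truncCone α β :=
      (mem_principal_self _ : truncCone α β ∈ 𝓟 (truncCone α β)) |> mem_inf_of_right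
    filter_upwards [hne, hin] with z hz0 hz
    rw [add_sub_cancel, div_sub_one hz0, norm_div]
    have := (hψ z (hcone z hz)).1
    gcongr

/-! ### Cauchy distributions, translations and classical convolution -/

lemma fTransform_eq_of_cauchyTransform_eq {μ : Measure ℝ} {z w : ℂ}
    (h : cauchyTransform μ z = 1 / w) : fTransform μ z = w := by
  rw [fTransform, h, one_div_one_div]

lemma cauchyTransform_cauchyMeasure (γ : ℝ≥0) {z : ℂ} (hz : 0 < z.im) :
    cauchyTransform (cauchyMeasure 0 γ) z = 1 / (z + (γ : ℝ) * Complex.I) := by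
  rcases eq_or_ne γ 0 with rfl | hγ
  · rw [cauchyMeasure_zero_scale, cauchyTransform, integral_dirac]
    simp
  have hγ0 : (0 : ℝ) < γ := by positivity
  have hden : ∀ ζ : ℂ, 0 ≤ ζ.im → (γ : ℝ) ≤ ‖ζ - -((γ : ℝ) * Complex.I)‖ := by
    intro ζ hζ
    refine le_trans ?_ ((le_abs_self _).trans (Complex.abs_im_le_norm _))
    simp [hζ]
  have hne : ∀ ζ : ℂ, 0 ≤ ζ.im → ζ + (γ : ℝ) * Complex.I ≠ 0 := by
    intro ζ hζ
    have := norm_pos_iff.1 (hγ0.trans_le (hden ζ hζ))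
    rwa [sub_neg_eq_add] at this
  have hd : DifferentiableOn ℂ (fun ζ : ℂ => 1 / (ζ + (γ : ℝ) * Complex.I)) {z | 0 ≤ z.im} :=
    DifferentiableOn.div (by fun_prop) (by fun_prop) hne
  have hrep := eq_integral_neg_im_div_pi (C := (1 + ‖((γ : ℝ) : ℂ)‖) / γ + 1) hd (by
    intro ζ hζ
    rw [norm_div, norm_one, div_le_div_iff₀ (norm_pos_iff.2 (hne ζ hζ)) (by positivity), one_mul]
    have := one_add_norm_le_mul_norm_sub (z := ((γ : ℝ) : ℂ)) hγ0 (hden ζ hζ) (by simp)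
    rwa [sub_neg_eq_add] at this) hz
  rw [hrep, cauchyMeasure_of_scale_ne_zero 0 hγ]
  have : cauchyPDF 0 γ = fun x => ENNReal.ofReal (cauchyPDFReal 0 γ x) := rfl
  rw [cauchyTransform, this, integral_withDensity_ofReal (measurable_cauchyPDFReal 0 γ)
    (fun x => (cauchyPDF_pos 0 hγ x).le)]
  congr 1
  ext x
  congr 2
  rw [one_div, Complex.inv_im, cauchyPDFReal_def, Complex.normSq_apply]
  simp
  field_simp

lemma fTransform_cauchyMeasure (γ : ℝ≥0) {z : ℂ} (hz : 0 < z.im) :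
    fTransform (cauchyMeasure 0 γ) z = z + (γ : ℝ) * Complex.I :=
  fTransform_eq_of_cauchyTransform_eq (cauchyTransform_cauchyMeasure γ hz)

lemma fTransform_conv_cauchyMeasure (μ : Measure ℝ) [IsProbabilityMeasure μ] (γ : ℝ≥0) {z : ℂ}
    (hz : 0 < z.im) :
    fTransform (μ.conv (cauchyMeasure 0 γ)) z = fTransform μ (z + (γ : ℝ) * Complex.I) := by
  rw [fTransform, fTransform, cauchyTransform, integral_conv (integrable_one_div_sub hz)]
  congr 1
  rw [cauchyTransform]
  congr 1
  ext t
  have h := cauchyTransform_cauchyMeasure γ (z := z - t) (by simpa using hz)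
  rw [cauchyTransform] at h
  rw [← sub_add_eq_add_sub, ← h]
  congr 1
  ext x
  push_cast
  rw [sub_sub]

lemma fTransform_map_sub_const (μ : Measure ℝ) [IsProbabilityMeasure μ] (m : ℝ) {z : ℂ}
    (hz : 0 < z.im) : fTransform (μ.map fun t => t - m) z = fTransform μ (z + m) := by
  rw [fTransform, fTransform, cauchyTransform, cauchyTransform,
    integral_map (by fun_prop) (continuous_one_div_sub hz).aestronglyMeasurable]
  congr 2
  ext t
  congr 1
  push_cast
  ring

/-! ### The deconvolved measure and the convolution identity -/

section Deconvolution

variable {μ₁ μ₃ : Measure ℝ} [IsProbabilityMeasure μ₁] [IsProbabilityMeasure μ₃] {c : ℝ}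

lemma add_mul_I_bounds {V : ℝ} (hc : 0 ≤ c) (hV : 8 * V ≤ c ^ 2) {z : ℂ} (hz : 0 < z.im) :
    0 < (z + c * Complex.I).im ∧ 8 * V < (z + c * Complex.I).im ^ 2 := by
  have him : (z + c * Complex.I).im = z.im + c := by simp
  rw [him]
  constructor
  · linarith
  · nlinarith [mul_nonneg hz.le hc, mul_pos hz hz]

lemma differentiableOn_fTransform_omega₃ (h₁ : MemLp id 2 μ₁) {s : ℝ} (hs : 0 < s)
    (hV : 8 * variance id μ₁ < s ^ 2) :
    DifferentiableOn ℂ (fun z => fTransform μ₃ (omega₃ μ₁ μ₃ z)) (halfPlane s) := by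
  refine differentiableOn_fTransform.comp (differentiableOn_omega₃ h₁ hs hV) fun z hz => ?_
  have hz' : s < z.im := hz
  have hz0 : 0 < z.im := hs.trans hz'
  have h : 3 * z.im / 4 < (omega₃ μ₁ μ₃ z).im :=
    omega₃_mem_halfPlane h₁ hz0 (hV.trans (by gcongr))
  exact lt_trans (by linarith) h

lemma differentiableOn_fTransform_omega₃_shift (h₁ : MemLp id 2 μ₁) (hc : 0 ≤ c)
    (hV : 8 * variance id μ₁ ≤ c ^ 2) :
    DifferentiableOn ℂ (fun z => fTransform μ₃ (omega₃ μ₁ μ₃ (z + c * Complex.I)))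
      (halfPlane 0) := by
  intro z hz
  have hz' : 0 < z.im := hz
  have h1 := add_mul_I_bounds hc hV (z := ⟨0, z.im / 2⟩) (half_pos hz')
  have him : ((⟨0, z.im / 2⟩ : ℂ) + c * Complex.I).im = z.im / 2 + c := by simp
  rw [him] at h1
  have h2 := (differentiableOn_fTransform_omega₃ (μ₃ := μ₃) h₁ h1.1 h1.2).differentiableAt
    ((isOpen_halfPlane _).mem_nhds (show z + c * Complex.I ∈ halfPlane (z.im / 2 + c) by
      change _ < (z + c * Complex.I).im
      simp
      exact hz'))
  exact (DifferentiableAt.fun_comp' (f := fun z : ℂ => z + c * Complex.I) z h2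
    (by fun_prop)).differentiableWithinAt

/-- The distance of `F_{μ₃}(ω₃(z + ic))` from `z`, in terms of a lower bound `s` on
`Im (z + ic)`. -/
lemma norm_fTransform_omega₃_sub_le (h₁ : MemLp id 2 μ₁) (h₃ : MemLp id 2 μ₃) (hc : 0 ≤ c)
    (hV : 8 * variance id μ₁ ≤ c ^ 2) {s : ℝ} (hs : 0 < s) {z : ℂ} (hz : 0 < z.im)
    (hsz : s ≤ (z + c * Complex.I).im) :
    ‖fTransform μ₃ (omega₃ μ₁ μ₃ (z + c * Complex.I)) - z‖ ≤
      (|∫ t, t ∂μ₃| + variance id μ₃ / (3 * s / 4)) +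
        (|∫ t, t ∂μ₁| + 2 * variance id μ₁ / s) + c := by
  obtain ⟨hZ, hVZ⟩ := add_mul_I_bounds hc hV hz
  have hV1 := variance_nonneg (id : ℝ → ℝ) μ₁
  set Z := z + c * Complex.I with hZdef
  have h1 := norm_omega₃_sub_le (μ₃ := μ₃) h₁ hZ hVZ
  have h2 : 3 * Z.im / 4 < (omega₃ μ₁ μ₃ Z).im := omega₃_mem_halfPlane h₁ hZ hVZ
  have h3 := norm_fTransform_sub_le h₃ (s := 3 * s / 4) (by positivity)
    (show 3 * s / 4 < (omega₃ μ₁ μ₃ Z).im by linarith)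
  have h4 : 2 * variance id μ₁ / Z.im ≤ 2 * variance id μ₁ / s := by gcongr
  set ω := omega₃ μ₁ μ₃ Z
  set m : ℝ := ∫ t, t ∂μ₁
  calc ‖fTransform μ₃ ω - z‖
      = ‖(fTransform μ₃ ω - ω) + ((m : ℂ) + (ω - Z - m)) + c * Complex.I‖ := by
        congr 1
        rw [hZdef]
        ring
    _ ≤ ‖fTransform μ₃ ω - ω‖ + (‖(m : ℂ)‖ + ‖ω - Z - m‖) + ‖c * Complex.I‖ :=
        norm_add₃_le.trans (by
          gcongr
          exact norm_add_le _ _)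
    _ ≤ _ := by
      rw [norm_mul, Complex.norm_I, mul_one, Complex.norm_real, Complex.norm_real,
        Real.norm_eq_abs, Real.norm_of_nonneg hc]
      gcongr
      exact h1.trans h4

theorem exists_fTransform_eq_omega₃ (h₁ : MemLp id 2 μ₁) (h₃ : MemLp id 2 μ₃) (hc : 0 ≤ c)
    (hV : 8 * variance id μ₁ = c ^ 2) :
    ∃ μt : Measure ℝ, IsProbabilityMeasure μt ∧ ∀ z ∈ halfPlane 0,
      fTransform μ₃ (omega₃ μ₁ μ₃ (z + c * Complex.I)) = fTransform μt z := by
  rcases hc.eq_or_lt with rfl | hc0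
  · -- `μ₁` is a point mass, so `ω₃` is the translation by its mean
    refine ⟨μ₃.map fun t => t - ∫ t, t ∂μ₁, Measure.isProbabilityMeasure_map (by fun_prop),
      fun z hz => ?_⟩
    have hz' : 0 < z.im := hz
    have hV0 : variance id μ₁ = 0 := by linarith
    have h := norm_omega₃_sub_le (μ₃ := μ₃) h₁ hz' (by
      rw [hV0, mul_zero]
      positivity)
    rw [hV0, mul_zero, zero_div] at h
    have h2 := norm_eq_zero.1 (le_antisymm h (norm_nonneg _))
    rw [fTransform_map_sub_const _ _ hz', Complex.ofReal_zero, zero_mul, add_zero]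
    congr 1
    linear_combination h2
  · refine exists_fTransform_eq (δ := 3 * c / 4) (by positivity)
      (differentiableOn_fTransform_omega₃_shift h₁ hc hV.le)
      (fun z hz => norm_fTransform_omega₃_sub_le h₁ h₃ hc hV.le hc0 hz ?_) fun z hz => ?_
    · have hz' : 0 < z.im := hz
      simp
      exact hz'.le
    · have hz' : 0 < z.im := hz
      obtain ⟨hZ, hVZ⟩ := add_mul_I_bounds hc hV.le hz'
      have h2 : 3 * (z + c * Complex.I).im / 4 < (omega₃ μ₁ μ₃ (z + c * Complex.I)).im :=
        omega₃_mem_halfPlane h₁ hZ hVZ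
      have him : (z + c * Complex.I).im = z.im + c := by simp
      rw [him] at h2
      have := im_le_im_fTransform (μ := μ₃)
        (show 0 < (omega₃ μ₁ μ₃ (z + c * Complex.I)).im by linarith)
      linarith

/-- The convolution identity, by subordination. If `F_{μt}(b) = ζ`, then with `ω = ω₃(b + iγ)` the
points `a = ζ + ω - (b + iγ)` and `u = ω - iγ` satisfy `F_{μ₁}(a) = ζ` and `F_ρ(u) = ζ`, where `ρ`
is the classical convolution of `μ₃` with the Cauchy distribution. So `a`, `b`, `u` are the values
at `ζ` of the three inverse functions, and `a + b = ζ + u`. -/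
theorem isFreeAddConv_of_fTransform_eq_omega₃ (h₁ : MemLp id 2 μ₁) (h₃ : MemLp id 2 μ₃)
    {γ : ℝ≥0} (hV : 8 * variance id μ₁ = (γ : ℝ) ^ 2) {μt : Measure ℝ} [IsProbabilityMeasure μt]
    (hμt : ∀ z ∈ halfPlane 0,
      fTransform μ₃ (omega₃ μ₁ μ₃ (z + (γ : ℝ) * Complex.I)) = fTransform μt z) :
    IsFreeAddConv μ₁ μt (μ₃.conv (cauchyMeasure 0 γ)) ∧
      IsFreeAddConv μ₃ (cauchyMeasure 0 γ) (μ₃.conv (cauchyMeasure 0 γ)) := by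
  set ρ := μ₃.conv (cauchyMeasure 0 γ) with hρ
  have hγ : 0 ≤ (γ : ℝ) := γ.2
  set c : ℝ := (γ : ℝ) with hc
  have hV1 := variance_nonneg (id : ℝ → ℝ) μ₁
  have hV3 := variance_nonneg (id : ℝ → ℝ) μ₃
  -- all five `F`-transforms are within `K` of the identity on `Im z > 1`
  obtain ⟨K, hK⟩ : ∃ K : ℝ, K = |∫ t, t ∂μ₁| + |∫ t, t ∂μ₃| + 2 * variance id μ₁ +
      2 * variance id μ₃ + c + 1 := ⟨_, rfl⟩
  have ha1 := abs_nonneg (∫ t, t ∂μ₁)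
  have ha3 := abs_nonneg (∫ t, t ∂μ₃)
  have hK0 : 0 < K := by linarith
  have hcK : c ≤ K := by linarith
  have hpos : ∀ z ∈ halfPlane 1, 0 < z.im := fun z hz => one_pos.trans hz
  have hcI : ‖(c : ℂ) * Complex.I‖ = c := by
    rw [norm_mul, Complex.norm_I, mul_one, Complex.norm_real, Real.norm_of_nonneg hγ]
  have hb1 : ∀ z ∈ halfPlane 1, ‖fTransform μ₁ z - z‖ ≤ K := by
    intro z hz
    have := norm_fTransform_sub_le h₁ one_pos hz
    rw [div_one] at this
    linarith
  have hb3 : ∀ z ∈ halfPlane 1, ‖fTransform μ₃ z - z‖ ≤ |∫ t, t ∂μ₃| + variance id μ₃ := by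
    intro z hz
    have := norm_fTransform_sub_le h₃ one_pos hz
    rwa [div_one] at this
  have hbC : ∀ z ∈ halfPlane 1, ‖fTransform (cauchyMeasure 0 γ) z - z‖ ≤ K := by
    intro z hz
    rw [fTransform_cauchyMeasure γ (hpos z hz), add_sub_cancel_left, hcI]
    exact hcK
  have hbρ : ∀ z ∈ halfPlane 1, ‖fTransform ρ z - z‖ ≤ K := by
    intro z hz
    have hz' : (1 : ℝ) < z.im := hz
    have hmem : z + (c : ℂ) * Complex.I ∈ halfPlane 1 := by
      change 1 < (z + (c : ℂ) * Complex.I).im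
      simp
      linarith
    rw [hρ, fTransform_conv_cauchyMeasure μ₃ γ (hpos z hz)]
    have h := norm_add_le (fTransform μ₃ (z + c * Complex.I) - (z + c * Complex.I)) (c * Complex.I)
    have h' := hb3 _ hmem
    have e : fTransform μ₃ (z + c * Complex.I) - (z + c * Complex.I) + c * Complex.I =
        fTransform μ₃ (z + c * Complex.I) - z := by ring
    rw [e, hcI] at h
    linarith
  have hbt : ∀ z ∈ halfPlane 1, ‖fTransform μt z - z‖ ≤ K := by
    intro z hz
    have hz' : (1 : ℝ) < z.im := hz
    rw [← hμt z (hpos z hz)]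
    have h := norm_fTransform_omega₃_sub_le h₁ h₃ hγ hV.le one_pos (hpos z hz) (by
      simp
      linarith)
    rw [div_one] at h
    have h2 : variance id μ₃ / (3 * 1 / 4) ≤ 2 * variance id μ₃ := by
      rw [div_le_iff₀ (by norm_num)]
      linarith
    linarith
  have hdiff : ∀ (μ : Measure ℝ) [IsProbabilityMeasure μ],
      DifferentiableOn ℂ (fTransform μ) (halfPlane 1) := fun μ _ =>
    differentiableOn_fTransform.mono hpos
  obtain ⟨ψ₁, hd₁, hψ₁⟩ := exists_rightInverse hK0 (hdiff μ₁) hb1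
  obtain ⟨ψ₃, hd₃, hψ₃⟩ := exists_rightInverse hK0 (hdiff μ₃) fun z hz => (hb3 z hz).trans (by
    linarith)
  obtain ⟨ψC, hdC, hψC⟩ := exists_rightInverse hK0 (hdiff (cauchyMeasure 0 γ)) hbC
  obtain ⟨ψρ, hdρ, hψρ⟩ := exists_rightInverse hK0 (hdiff ρ) hbρ
  obtain ⟨ψt, hdt, hψt⟩ := exists_rightInverse hK0 (hdiff μt) hbt
  have hvoic : ∀ (μ : Measure ℝ) (ψ : ℂ → ℂ) (α : ℝ),
      DifferentiableOn ℂ ψ (halfPlane (1 + 3 * K)) →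
      (∀ z ∈ halfPlane (1 + 3 * K), ‖ψ z - z‖ ≤ K ∧ fTransform μ (ψ z) = z ∧
        ∀ w ∈ halfPlane (1 + 2 * K), fTransform μ w = z → w = ψ z) →
      IsVoiculescuTransformOn μ α (1 + 4 * K) (fun z => ψ z - z) := fun μ ψ α hd hψ =>
    isVoiculescuTransformOn_of_rightInverse (K := K) (by linarith) (by linarith) hd
      fun z hz => ⟨(hψ z hz).1, (hψ z hz).2.1⟩
  have him : ∀ {p q : ℂ}, ‖p - q‖ ≤ K → q.im - K ≤ p.im := by
    intro p q hpq
    have := (abs_le.1 ((Complex.abs_im_le_norm (p - q)).trans hpq)).1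
    rw [Complex.sub_im] at this
    linarith
  refine ⟨⟨inferInstance, inferInstance, inferInstance, fun α _ => ⟨1 + 4 * K, by positivity, _, _,
    _, hvoic μ₁ ψ₁ α hd₁ hψ₁, hvoic μt ψt α hdt hψt, hvoic ρ ψρ α hdρ hψρ, fun z hz => ?_⟩⟩,
    ⟨inferInstance, inferInstance, inferInstance, fun α _ => ⟨1 + 4 * K, by positivity, _, _,
    _, hvoic μ₃ ψ₃ α hd₃ hψ₃, hvoic _ ψC α hdC hψC, hvoic ρ ψρ α hdρ hψρ, fun z hz => ?_⟩⟩⟩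
  · have hz1 : 1 + 4 * K < z.im := hz.1
    have hzm : z ∈ halfPlane (1 + 3 * K) := lt_trans (by linarith) hz1
    obtain ⟨hbz, hFb, -⟩ := hψt z hzm
    have hbim := him hbz
    set b := ψt z
    have hb0 : 0 < b.im := by linarith
    obtain ⟨hZ, hVZ⟩ := add_mul_I_bounds hγ hV.le hb0
    have hZim : (b + c * Complex.I).im = b.im + c := by simp
    have hω := norm_omega₃_sub_le (μ₃ := μ₃) h₁ hZ hVZ
    have hsub := fTransform_hTilde_omega₃ (μ₃ := μ₃) h₁ hZ hVZ
    rw [hμt b hb0, hFb] at hsub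
    have hF3 := hμt b hb0
    rw [hFb] at hF3
    set ω := omega₃ μ₁ μ₃ (b + c * Complex.I)
    have hωK : ‖ω - (b + c * Complex.I)‖ ≤ K := by
      have h5 : 2 * variance id μ₁ / (b + c * Complex.I).im ≤ 2 * variance id μ₁ := by
        rw [hZim]
        exact div_le_self (by positivity) (by linarith)
      have h6 := norm_add_le (ω - (b + c * Complex.I) - ((∫ t, t ∂μ₁ : ℝ) : ℂ))
        ((∫ t, t ∂μ₁ : ℝ) : ℂ)
      rw [sub_add_cancel, Complex.norm_real, Real.norm_eq_abs] at h6
      linarith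
    have ha : z + ω - (b + c * Complex.I) = ψ₁ z := by
      refine (hψ₁ z hzm).2.2 _ ?_ hsub
      have h7 : ‖(z + ω - (b + c * Complex.I)) - z‖ ≤ K := by
        rwa [show z + ω - (b + c * Complex.I) - z = ω - (b + c * Complex.I) by ring]
      have := him h7
      change 1 + 2 * K < _
      linarith
    have hu : ω - c * Complex.I = ψρ z := by
      have h8 : ‖(ω - c * Complex.I) - b‖ ≤ K := by
        rwa [show ω - c * Complex.I - b = ω - (b + c * Complex.I) by ring]
      have h9 := him h8
      refine (hψρ z hzm).2.2 _ ?_ ?_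
      · change 1 + 2 * K < _
        linarith
      · rw [hρ, fTransform_conv_cauchyMeasure μ₃ γ (by linarith), ← hc, sub_add_cancel]
        exact hF3
    rw [← ha, ← hu]
    ring
  · have hz1 : 1 + 4 * K < z.im := hz.1
    have hzm : z ∈ halfPlane (1 + 3 * K) := lt_trans (by linarith) hz1
    have hcim : ∀ p : ℂ, (p - c * Complex.I).im = p.im - c := by
      intro p
      simp
    have hC : z - c * Complex.I = ψC z := by
      have h1 := hcim z
      refine (hψC z hzm).2.2 _ ?_ ?_
      · change 1 + 2 * K < _
        linarith
      · rw [fTransform_cauchyMeasure γ (by linarith), ← hc, sub_add_cancel]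
    obtain ⟨h3z, hF3, -⟩ := hψ₃ z hzm
    have hu : ψ₃ z - c * Complex.I = ψρ z := by
      have h1 := hcim (ψ₃ z)
      have h2 := him h3z
      refine (hψρ z hzm).2.2 _ ?_ ?_
      · change 1 + 2 * K < _
        linarith
      · rw [hρ, fTransform_conv_cauchyMeasure μ₃ γ (by linarith), ← hc, sub_add_cancel]
        exact hF3
    rw [← hC, ← hu]
    ring

end Deconvolution

end FreeDeconv

theorem theorem1p3 (μ₁ μ₃ : Measure ℝ) [IsProbabilityMeasure μ₁] [IsProbabilityMeasure μ₃]
    (h₁ : MemLp id 2 μ₁) (h₃ : MemLp id 2 μ₃)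
    (σ₁ : ℝ≥0) (hσ₁ : variance id μ₁ = (σ₁ : ℝ) ^ 2) :
    -- `ω₃` is well defined on `Im z > 2√2 σ₁`, with values in the upper half-plane
    (∀ z ∈ halfPlane (2 * √2 * (σ₁ : ℝ)),
      omega₃ μ₁ μ₃ z ∈ halfPlane 0 ∧
      ∀ w : ℂ, 3 * z.im / 4 < w.im →
        Tendsto (fun n : ℕ => (deconvMap μ₁ μ₃ z)^[n] w) atTop (𝓝 (omega₃ μ₁ μ₃ z))) ∧
    AnalyticOnNhd ℂ
      (fun z => fTransform μ₃ (omega₃ μ₁ μ₃ (z + ((2 * √2 * (σ₁ : ℝ) : ℝ) : ℂ) * Complex.I)))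
      (halfPlane 0) ∧
    ∃ μt : Measure ℝ, IsProbabilityMeasure μt ∧
      (∀ z ∈ halfPlane 0,
        fTransform μ₃ (omega₃ μ₁ μ₃ (z + ((2 * √2 * (σ₁ : ℝ) : ℝ) : ℂ) * Complex.I)) =
          fTransform μt z) ∧
      -- `μ₁ ⊞ μt = μ₃ ⊞ C`, both sides being the probability measure `ρ`
      ∃ ρ : Measure ℝ, IsProbabilityMeasure ρ ∧
        IsFreeAddConv μ₁ μt ρ ∧
        IsFreeAddConv μ₃ (cauchyMeasure 0 (2 * NNReal.sqrt 2 * σ₁)) ρ := by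
  have hc : 0 ≤ 2 * √2 * (σ₁ : ℝ) := by positivity
  have hV : 8 * variance id μ₁ = (2 * √2 * (σ₁ : ℝ)) ^ 2 := by
    rw [hσ₁, mul_pow, mul_pow, Real.sq_sqrt (by norm_num)]
    ring
  have hγ : ((2 * NNReal.sqrt 2 * σ₁ : ℝ≥0) : ℝ) = 2 * √2 * (σ₁ : ℝ) := by simp
  refine ⟨fun z hz => ?_, ?_, ?_⟩
  · have hz0 := pos_of_mem_halfPlane hc hz
    have hVz : 8 * variance id μ₁ < z.im ^ 2 := by
      rw [hV]
      exact pow_lt_pow_left₀ hz hc two_ne_zero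
    refine ⟨?_, fun w hw => tendsto_iterate_deconvMap h₁ hz0 hVz hw⟩
    have h : 3 * z.im / 4 < (omega₃ μ₁ μ₃ z).im := omega₃_mem_halfPlane h₁ hz0 hVz
    exact lt_trans (by linarith) h
  · exact (differentiableOn_fTransform_omega₃_shift h₁ hc hV.le).analyticOnNhd (isOpen_halfPlane 0)
  · obtain ⟨μt, hμt, h⟩ := exists_fTransform_eq_omega₃ h₁ h₃ hc hV
    rw [← hγ] at hV
    obtain ⟨hl, hr⟩ := isFreeAddConv_of_fTransform_eq_omega₃ (μt := μt) h₁ h₃ hV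
      (by rwa [hγ])
    exact ⟨μt, hμt, h, _, hl.2.2.1, hl, hr⟩
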